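/- Let $A=(\alpha_k)_{k\in I}$ be a finite family of $N$ points of $\mathbb{R}^{1+n}$ (repetitions allowed) that spans $\mathbb{R}^{1+n}$ and lies on a hyperplane $\{\langle \xi,\cdot\rangle=1\}$ for some linear form $\xi$; such an $A$ is called a spectrum. For $c\in(\mathbb{C}^\times)^I$ consider the exponential sum $f_c(w)=\sum_{k\in I}c_k e^{\langle w,\alpha_k\rangle}$, $w\in\mathbb{C}^{1+n}$, and let $\check X_A\subset(\mathbb{C}^\times)^I$ be the set of all $c$ such that $f_c$ has a singular point, i.e. $f_c(w)=0$ and $df_c(w)=0$ for some $w\in\mathbb{C}^{1+n}$. The spectrum $A$ is called dual defective if $\check X_A$ has complex codimension at least $2$ in $\mathbb{C}^I$, i.e. every complex submanifold (the image of a holomorphic immersion of a nonempty open subset of some $\mathbb{C}^d$) contained in $\check X_A$ has dimension at most $N-2$; in particular $A$ is dual defective if $\check X_A$ is empty. A pyramid is a family all of whose points but one lie in a proper affine subspace of its affine hull. A circuit in $\mathbb{R}^{1+n}$ is a spectrum with exactly $n+2$ points which is not a pyramid. A family is an iterated circuit if, written as a matrix whose columns are its points, it can be brought by the left action of $\mathrm{GL}_{1+n}(\mathbb{R})$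 and an ordering of the columns to the upper diagonal form $$\begin{pmatrix}1&1&1&\cdots&1\\0&\tilde A_1&*&\cdots&*\\0&0&\tilde A_2&\cdots&*\\ \vdots&\vdots&\vdots&\ddots&\vdots\\0&0&0&\cdots&\tilde A_r\end{pmatrix},\qquad r\ge 1,$$ where the entries of the top row stand for rows of ones, and each diagonal configuration $A_j=\begin{pmatrix}1&1\\0&\tilde A_j\end{pmatrix}$ is a circuit. We say that $A$ contains an iterated circuit if some subfamily of $A$, regarded in the same space $\mathbb{R}^{1+n}$, is an iterated circuit. Theorem. A spectrum $A\subset\mathbb{R}^{1+n}$ is dual defective if and only if it contains no iterated circuit. -/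

import Mathlib

open scoped Matrix

noncomputable section

namespace ExpSum

/-- A finite family of points of `ℝ^{1+n}` (repetitions allowed) satisfying the two standing
assumptions on spectra: it lies on an affine hyperplane `⟨ξ, α⟩ = 1`, and it has full rank `1 + n`
(equivalently, such a `ξ` exists and is unique). -/
def IsSpectrum {ι : Type*} {n : ℕ} (A : ι → Fin (n + 1) → ℝ) : Prop :=
  (∃ ξ : Fin (n + 1) → ℝ, ∀ k, ξ ⬝ᵥ A k = 1) ∧ Submodule.span ℝ (Set.range A) = ⊤

/-- The exponential sum `f(w) = ∑ₖ cₖ exp ⟨w, αₖ⟩` on `ℂ^{1+n}`. -/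
def expSum {ι : Type*} [Fintype ι] {n : ℕ} (A : ι → Fin (n + 1) → ℝ) (c : ι → ℂ)
    (w : Fin (n + 1) → ℂ) : ℂ :=
  ∑ k, c k * Complex.exp (∑ i, w i * (A k i : ℂ))

/-- The discriminant (dual) variety: all coefficient vectors in `(ℂˣ)^A` whose exponential sum has
a singular point, that is, a zero at which its differential vanishes. -/
def dualVariety {ι : Type*} [Fintype ι] {n : ℕ} (A : ι → Fin (n + 1) → ℝ) : Set (ι → ℂ) :=
  {c | (∀ k, c k ≠ 0) ∧
    ∃ w : Fin (n + 1) → ℂ, expSum A c w = 0 ∧ fderiv ℂ (expSum A c) w = 0}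

/-- `S ⊆ ℂ^ι` contains a `d`-dimensional complex submanifold, given by a holomorphic immersion of a
nonempty open subset of `ℂ^d` (which is an embedding after shrinking the open set). -/
def ContainsManifoldOfDim {ι : Type*} [Fintype ι] (S : Set (ι → ℂ)) (d : ℕ) : Prop :=
  ∃ (U : Set (Fin d → ℂ)) (g : (Fin d → ℂ) → (ι → ℂ)),
    IsOpen U ∧ U.Nonempty ∧ DifferentiableOn ℂ g U ∧
      (∀ u ∈ U, Function.Injective (fderiv ℂ g u)) ∧ Set.MapsTo g U S

/-- `S ⊆ ℂ^ι` has complex codimension at least `p`, where the dimension of `S` is the largest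
dimension of a complex submanifold contained in `S`. The empty set has every codimension. -/
def CodimAtLeast {ι : Type*} [Fintype ι] (S : Set (ι → ℂ)) (p : ℕ) : Prop :=
  ∀ d : ℕ, ContainsManifoldOfDim S d → d + p ≤ Fintype.card ι

/-- Dual defective: the discriminant variety has codimension at least two. -/
def IsDualDefective {ι : Type*} [Fintype ι] {n : ℕ} (A : ι → Fin (n + 1) → ℝ) : Prop :=
  CodimAtLeast (dualVariety A) 2

/-- A pyramid: all points but one lie in a strict affine subspace of the affine hull. -/
def IsPyramid {ι : Type*} {n : ℕ} (A : ι → Fin (n + 1) → ℝ) : Prop :=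
  ∃ (k : ι) (H : AffineSubspace ℝ (Fin (n + 1) → ℝ)),
    H < affineSpan ℝ (Set.range A) ∧ ∀ l, l ≠ k → A l ∈ H

/-- A circuit: a spectrum of codimension `N - n - 1 = 1` that is not a pyramid. -/
def IsCircuit {ι : Type*} [Fintype ι] {n : ℕ} (A : ι → Fin (n + 1) → ℝ) : Prop :=
  IsSpectrum A ∧ Fintype.card ι = n + 2 ∧ ¬ IsPyramid A

/-- An upper diagonal form of `A`: an element `g` of `GL_{1+n}(ℝ)`, together with a partition of
the rows `1, …, n` and of the columns other than a chosen first one into blocks, such that the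
matrix `g A` has
top row `(1, …, 1)`, first column `(1, 0, …, 0)`, and zero blocks below the block diagonal. -/
structure UpperDiagonalForm {ι : Type*} {n : ℕ} (A : ι → Fin (n + 1) → ℝ) where
  /-- the number of diagonal blocks -/
  blocks : ℕ
  /-- the number of rows of each diagonal block -/
  rows : Fin blocks → ℕ
  /-- the number of columns of each diagonal block -/
  cols : Fin blocks → ℕ
  /-- the partition of the rows below the top row -/
  rowEquiv : (Σ j, Fin (rows j)) ≃ Fin n
  /-- the partition of the columns; `none` is the first column -/
  colEquiv : Option (Σ j, Fin (cols j)) ≃ ι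
  /-- the change of coordinates -/
  g : GL (Fin (n + 1)) ℝ
  top_row : ∀ k, (g.val *ᵥ A k) 0 = 1
  first_col : ∀ i : Fin n, (g.val *ᵥ A (colEquiv none)) i.succ = 0
  lower : ∀ (i j : Fin blocks) (p : Fin (rows i)) (q : Fin (cols j)), j < i →
    (g.val *ᵥ A (colEquiv (some ⟨j, q⟩))) (rowEquiv ⟨i, p⟩).succ = 0

/-- The `j`-th diagonal configuration, with columns `(1, 0)` and `(1, x)`, where `x` runs over the
columns of the `j`-th diagonal block. -/
def UpperDiagonalForm.diagonalConfig {ι : Type*} {n : ℕ} {A : ι → Fin (n + 1) → ℝ}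
    (F : UpperDiagonalForm A) (j : Fin F.blocks) :
    Fin (F.cols j + 1) → Fin (F.rows j + 1) → ℝ :=
  Fin.cons (Fin.cons 1 0) fun q =>
    Fin.cons 1 fun p => (F.g.val *ᵥ A (F.colEquiv (some ⟨j, q⟩))) (F.rowEquiv ⟨j, p⟩).succ

/-- An iterated circuit: it has an upper diagonal form with at least one block, all of whose
diagonal configurations are circuits. -/
def IsIteratedCircuit {ι : Type*} {n : ℕ} (A : ι → Fin (n + 1) → ℝ) : Prop :=
  ∃ F : UpperDiagonalForm A, 0 < F.blocks ∧ ∀ j, IsCircuit (F.diagonalConfig j)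

/-- Some subfamily, regarded in the same `ℝ^{1+n}`, is an iterated circuit. -/
def ContainsIteratedCircuit {ι : Type*} {n : ℕ} (A : ι → Fin (n + 1) → ℝ) : Prop :=
  ∃ s : Set ι, IsIteratedCircuit fun k : s => A k

end ExpSum

end

/-!
Up to the substitution `c = (b_k exp ⟨w, α_k⟩)`, the coefficient vectors of singular exponential
sums are the linear relations `∑ b_k α_k = 0` with nonzero entries (`exists_hornKapranov_eq`,
`hornKapranov_mem_dualVariety`). The derivative of `(b, w) ↦ (b_k exp ⟨w, α_k⟩)` at a relation `b`
kills `(β, w)` exactly when `β_k = -b_k ⟨w, α_k⟩`, and since `β` is again a relation, `w` lies in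
the radical of the quadratic form `Q_b(v) = ∑ b_k ⟨v, α_k⟩²`. The form `ξ` which is `1` on the
spectrum always lies in this radical. If the radical of some `Q_b` is spanned by `ξ`, a slice of the
parametrization is an immersion in dimension `N - 1`; if there is no such `b`, a projection of the
discriminant variety to `ℂ^(N-1)` is a set of critical values, hence null by the easy case of Sard's
theorem, and the variety contains no hypersurface. So the spectrum is not dual defective if and only
if it has such a nondegenerate relation (`isDualDefective_iff`). The rank condition is Zariski open
on a real vector space of relations, so complex and real relations are equivalent here
(`IsNondegenerateComplex.exists_real`, `IsNondegenerate.complex`).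

A nondegenerate real relation `b` yields an iterated circuit (`IsNondegenerate.exists_chain`). If
every relation is a multiple of `b`, the configuration is a circuit. Otherwise take a generic second
relation `c` and sort the points into classes according to the value of `c_k / b_k`. The dimension
of the space `W` of linear forms modulo `ξ` is less than the number of points, while the generalized
eigenspaces of the pencil `Q_c - τ Q_b` on `W` are independent. Hence for some value `τ`, with class
`E`, the eigenspace has dimension less than `|E|`, which is as small as possible
(`exists_pencil_root`). It follows that `c - τ b` is a nondegenerate relation on the points outside
`E`, and that `E` forms a circuit modulo these points (`IsNondegenerate.exists_split`,
`isCircuitModulo_of_forall_relations`). By induction the configuration contains a chain: a base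
point and levels of further points, each forming a circuit with the base point modulo the earlier
levels. A basis adapted to the levels turns a spanning chain into an upper diagonal form
(`IsChain.isIteratedCircuit`), and upper diagonal forms with circuits as diagonal configurations
give chains (`UpperDiagonalForm.exists_isChain`).

Conversely, a chain carries a nondegenerate relation (`IsChain.exists_relation`): add to a relation
of the lower levels a small multiple of a relation whose top part is the circuit relation. The form
of the lower levels has in its radical only the linear forms that are constant on these levels. On
them the form of the circuit is nondegenerate modulo `ξ`, so a small perturbation of the former by
the latter has the smallest possible radical (`eventually_ker_sub_smul_eq_bot`).
-/


noncomputable section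

namespace ExpSum

open Module Filter
open scoped Matrix Topology

/-! ### Pencils of symmetric bilinear forms -/

theorem sum_finrank_le_of_iSupIndep {K W κ : Type*} [Field K] [AddCommGroup W] [Module K W]
    [FiniteDimensional K W] {p : κ → Submodule K W} (hp : iSupIndep p) (t : Finset κ) :
    ∑ i ∈ t, finrank K (p i) ≤ finrank K W := by
  classical
  have key : ∑ i ∈ t, finrank K (p i) = finrank K (t.sup p : Submodule K W) := by
    induction t using Finset.induction_on with
    | empty => rw [Finset.sum_empty, Finset.sup_empty, finrank_bot]
    | insert a t ha ih =>
      have hdis : Disjoint (p a) (t.sup p) :=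
        hp.supIndep' (insert a t) (Finset.subset_insert a t) (Finset.mem_insert_self a t) ha
      rw [Finset.sum_insert ha, ih, Finset.sup_insert, ← Submodule.finrank_sup_add_finrank_inf_eq,
        hdis.eq_bot, finrank_bot, add_zero]
  rw [key]
  exact Submodule.finrank_le _

/-- Roots of the pencil `B₀ - τ B₁` are eigenvalues of `B₁⁻¹ B₀`, so the dimensions of the
generalized eigenspaces attached to the values `t k` cannot all reach the multiplicities of these
values once there are more indices than dimensions. If the radical of `B₀ - τ B₁` is as large as
the resulting bound permits, then `τ` is a semisimple eigenvalue, and hence `B₁` is nondegenerate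
on that radical. -/
theorem exists_pencil_root {W κ : Type*} [AddCommGroup W] [Module ℝ W] [FiniteDimensional ℝ W]
    (B₀ B₁ : W →ₗ[ℝ] W →ₗ[ℝ] ℝ) (h₀ : ∀ u v, B₀ u v = B₀ v u) (h₁ : ∀ u v, B₁ u v = B₁ v u)
    (hn : ∀ u, (∀ v, B₁ u v = 0) → u = 0) (s : Finset κ) (t : κ → ℝ)
    (hs : finrank ℝ W < s.card) :
    ∃ τ ∈ s.image t,
      finrank ℝ (LinearMap.ker (B₀ - τ • B₁)) < (s.filter fun k => t k = τ).card ∧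
      ((s.filter fun k => t k = τ).card ≤ finrank ℝ (LinearMap.ker (B₀ - τ • B₁)) + 1 →
        ∀ u ∈ LinearMap.ker (B₀ - τ • B₁),
          (∀ v ∈ LinearMap.ker (B₀ - τ • B₁), B₁ u v = 0) → u = 0) := by
  classical
  have hinj : Function.Injective B₁ := by
    rw [← LinearMap.ker_eq_bot, LinearMap.ker_eq_bot']
    intro u hu
    exact hn u fun v => by rw [hu]; rfl
  let e : W ≃ₗ[ℝ] (W →ₗ[ℝ] ℝ) :=
    LinearEquiv.ofInjectiveOfFinrankEq B₁ hinj (Subspace.dual_finrank_eq (K := ℝ) (V := W)).symm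
  have he : ∀ u, e u = B₁ u := fun u => rfl
  let X : End ℝ W := e.symm.toLinearMap ∘ₗ B₀
  have hX : ∀ u v, B₁ (X u) v = B₀ u v := by
    intro u v
    rw [← he]
    simp [X]
  have hXs : ∀ u v, B₁ (X u) v = B₁ u (X v) := by
    intro u v
    rw [hX, h₁ u, hX, h₀]
  have hker : ∀ (τ : ℝ) (u : W), u ∈ LinearMap.ker (B₀ - τ • B₁) ↔ X u = τ • u := by
    intro τ u
    rw [LinearMap.mem_ker, LinearMap.sub_apply, sub_eq_zero, ← hinj.eq_iff]
    constructor
    · intro h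
      ext v
      rw [hX, h]; simp
    · intro h
      ext v
      rw [← hX, h]; simp
  -- generalized eigenspaces for distinct values are independent, whereas the multiplicities of the
  -- values `t k` add up to more than the dimension
  have hlt : ∃ τ ∈ s.image t,
      finrank ℝ (X.genEigenspace τ 2) < (s.filter fun k => t k = τ).card := by
    by_contra! hcon
    have h1 := Finset.sum_le_sum hcon
    rw [← Finset.card_eq_sum_card_image] at h1
    have h2 := sum_finrank_le_of_iSupIndep (X.independent_genEigenspace 2) (s.image t)
    omega
  obtain ⟨τ, hτ, hlt⟩ := hlt
  have hmem2 : ∀ u, u ∈ X.genEigenspace τ 2 ↔ X (X u - τ • u) = τ • (X u - τ • u) := by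
    intro u
    have : u ∈ X.genEigenspace τ ((2 : ℕ) : ℕ∞) ↔ _ := Module.End.mem_genEigenspace_nat
    rw [show (2 : ℕ∞) = ((2 : ℕ) : ℕ∞) from rfl, this, LinearMap.mem_ker, pow_two,
      Module.End.mul_apply, LinearMap.sub_apply, sub_eq_zero]
    simp
  have hle : LinearMap.ker (B₀ - τ • B₁) ≤ X.genEigenspace τ 2 := by
    intro u hu
    rw [hker] at hu
    rw [hmem2, hu]; simp
  have hfr := Submodule.finrank_mono hle
  refine ⟨τ, hτ, lt_of_le_of_lt hfr hlt, fun hcard u hu horth => ?_⟩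
  have heq : LinearMap.ker (B₀ - τ • B₁) = X.genEigenspace τ 2 :=
    Submodule.eq_of_le_of_finrank_le hle (by omega)
  let Y : End ℝ W := X - τ • LinearMap.id
  have hY : ∀ w, Y w = X w - τ • w := fun w => rfl
  have hkerY : LinearMap.ker Y = LinearMap.ker (B₀ - τ • B₁) := by
    ext w
    rw [hker, LinearMap.mem_ker, hY, sub_eq_zero]
  -- `ker Y ∩ range Y = 0` since `ker Y² = ker Y`; as `Y` is self-adjoint for `B₁`, the two summands
  -- of `W = ker Y ⊕ range Y` are orthogonal
  have hdisj : Disjoint (LinearMap.ker Y) (LinearMap.range Y) := by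
    rw [Submodule.disjoint_def]
    rintro _ hx ⟨y, rfl⟩
    rw [hkerY, hker] at hx
    have : y ∈ LinearMap.ker (B₀ - τ • B₁) := by
      rw [heq, hmem2, ← hY]; exact hx
    rwa [← hkerY, LinearMap.mem_ker] at this
  have htop : LinearMap.ker Y ⊔ LinearMap.range Y = ⊤ := by
    apply Submodule.eq_top_of_disjoint _ _ _ hdisj
    rw [add_comm, LinearMap.finrank_range_add_finrank_ker]
  refine hn u fun v => ?_
  have hv : v ∈ LinearMap.ker Y ⊔ LinearMap.range Y := htop ▸ Submodule.mem_top
  obtain ⟨a, ha, _, ⟨y, rfl⟩, rfl⟩ := Submodule.mem_sup.1 hv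
  rw [map_add, horth a (hkerY ▸ ha), zero_add, hY, map_sub, ← hXs, (hker τ u).1 hu]
  simp

/-! ### Relations of a vector configuration -/

section Config

variable {ι V : Type*} [Fintype ι] [AddCommGroup V] [Module ℝ V]

/-- The linear relations among the vectors `A k` that are supported on `s`. -/
def relations (A : ι → V) (s : Finset ι) : Submodule ℝ (ι → ℝ) where
  carrier := {c | (∀ k ∉ s, c k = 0) ∧ ∑ k, c k • A k = 0}
  add_mem' := by
    rintro a b ⟨ha, ha'⟩ ⟨hb, hb'⟩
    refine ⟨fun k hk => by simp [ha k hk, hb k hk], ?_⟩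
    simp [add_smul, Finset.sum_add_distrib, ha', hb']
  zero_mem' := by simp
  smul_mem' := by
    rintro c a ⟨ha, ha'⟩
    refine ⟨fun k hk => by simp [ha k hk], ?_⟩
    simp [mul_smul, ← Finset.smul_sum, ha']

theorem mem_relations {A : ι → V} {s : Finset ι} {c : ι → ℝ} :
    c ∈ relations A s ↔ (∀ k ∉ s, c k = 0) ∧ ∑ k, c k • A k = 0 := Iff.rfl

theorem relations_mono (A : ι → V) {s t : Finset ι} (h : s ⊆ t) :
    relations A s ≤ relations A t := fun _ hc => ⟨fun k hk => hc.1 k fun h' => hk (h h'), hc.2⟩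

/-- The row space of a configuration is the annihilator of its relations. -/
theorem exists_dual_of_forall_relations (A : ι → V) (s : Finset ι) (f : ι → ℝ)
    (h : ∀ c ∈ relations A s, ∑ k, c k * f k = 0) :
    ∃ v : Dual ℝ V, ∀ k ∈ s, v (A k) = f k := by
  classical
  let Λ : (ι → ℝ) →ₗ[ℝ] V × (ι → ℝ) :=
    { toFun := fun c => (∑ k, c k • A k, fun k => if k ∈ s then 0 else c k)
      map_add' := by
        intro a b
        ext1
        · simp [add_smul, Finset.sum_add_distrib]
        · ext k
          by_cases hk : k ∈ s <;> simp [hk]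
      map_smul' := by
        intro r a
        ext1
        · simp [mul_smul, ← Finset.smul_sum]
        · ext k
          by_cases hk : k ∈ s <;> simp [hk] }
  let F : Dual ℝ (ι → ℝ) := ∑ k, f k • LinearMap.proj k
  have hF : ∀ c, F c = ∑ k, c k * f k := by
    intro c
    simp [F, mul_comm]
  have hmem : F ∈ (LinearMap.ker Λ).dualAnnihilator := by
    rw [Submodule.mem_dualAnnihilator]
    intro c hc
    rw [hF]
    apply h
    rw [LinearMap.mem_ker, Prod.ext_iff] at hc
    refine ⟨fun k hk => ?_, hc.1⟩
    have := congrFun hc.2 k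
    simpa [Λ, hk] using this
  rw [← LinearMap.range_dualMap_eq_dualAnnihilator_ker] at hmem
  obtain ⟨φ, hφ⟩ := hmem
  refine ⟨φ ∘ₗ LinearMap.inl ℝ V (ι → ℝ), fun k hk => ?_⟩
  have h1 : φ (Λ (Pi.single k 1)) = F (Pi.single k 1) := by rw [← hφ]; rfl
  rw [hF] at h1
  have h2 : Λ (Pi.single k 1) = (A k, 0) := by
    ext1
    · simp [Λ, Pi.single_apply]
    · ext l
      by_cases hl : l ∈ s
      · simp [Λ, hl]
      · have : l ≠ k := fun h' => hl (h' ▸ hk)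
        simp [Λ, hl, this]
  rw [h2] at h1
  simpa [Pi.single_apply] using h1

end Config

/-! ### Splitting off a block of a nondegenerate configuration -/

section Config

variable {ι V : Type*} [AddCommGroup V] [Module ℝ V]

/-- A relation `b` with support `s` is nondegenerate if the quadratic form `v ↦ ∑ bₖ v(Aₖ)²` has
the smallest possible radical: the linear forms that are constant on the `A k` with `k ∈ s`. -/
structure IsNondegenerate [Fintype ι] (A : ι → V) (s : Finset ι) (b : ι → ℝ) : Prop where
  mem : b ∈ relations A s
  ne_zero : ∀ k ∈ s, b k ≠ 0
  const : ∀ v : Dual ℝ V, ∑ k, (b k * v (A k)) • A k = 0 → ∃ c, ∀ k ∈ s, v (A k) = c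

theorem sum_eq_zero_of_mem_relations [Fintype ι] {A : ι → V} {ξ : Dual ℝ V} (hξ : ∀ k, ξ (A k) = 1)
    {s : Finset ι} {b : ι → ℝ} (hb : b ∈ relations A s) : ∑ k, b k = 0 := by
  have := congrArg ξ hb.2
  simpa [map_sum, hξ] using this

theorem dual_sum_eq_zero [Fintype ι] {A : ι → V} {s : Finset ι} {b : ι → ℝ} (hb : b ∈ relations A s)
    (v : Dual ℝ V) : ∑ k, b k * v (A k) = 0 := by
  have := congrArg v hb.2
  simpa [map_sum] using this

/-- The values on `s` of the linear forms, normalized to vanish at `A p`. -/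
def valueMap [DecidableEq ι] (A : ι → V) (s : Finset ι) (p : ι) : Dual ℝ V →ₗ[ℝ] (ι → ℝ) where
  toFun v := fun k => if k ∈ s then v (A k) - v (A p) else 0
  map_add' v w := by
    ext k
    by_cases hk : k ∈ s <;> simp [hk]; ring
  map_smul' r v := by
    ext k
    by_cases hk : k ∈ s <;> simp [hk]; ring

theorem valueMap_apply [DecidableEq ι] (A : ι → V) (s : Finset ι) (p : ι) (v : Dual ℝ V) (k : ι) :
    valueMap A s p v k = if k ∈ s then v (A k) - v (A p) else 0 := rfl

/-- The diagonal bilinear form with entries `b`. -/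
def diagForm [Fintype ι] (b : ι → ℝ) : (ι → ℝ) →ₗ[ℝ] (ι → ℝ) →ₗ[ℝ] ℝ :=
  LinearMap.mk₂ ℝ (fun u v => ∑ k, b k * u k * v k)
    (fun u v w => by rw [← Finset.sum_add_distrib]; congr 1; ext k; simp; ring)
    (fun r v w => by rw [smul_eq_mul, Finset.mul_sum]; congr 1; ext k; simp; ring)
    (fun u v w => by rw [← Finset.sum_add_distrib]; congr 1; ext k; simp; ring)
    (fun r v w => by rw [smul_eq_mul, Finset.mul_sum]; congr 1; ext k; simp; ring)

/-- The form `∑ₖ bₖ uₖ vₖ` on the normalized value vectors of linear forms. -/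
def valueForm [Fintype ι] [DecidableEq ι] (A : ι → V) (s : Finset ι) (p : ι) (b : ι → ℝ) :
    LinearMap.range (valueMap A s p) →ₗ[ℝ] LinearMap.range (valueMap A s p) →ₗ[ℝ] ℝ :=
  (diagForm b).domRestrict₁₂ _ _

theorem valueForm_apply [Fintype ι] [DecidableEq ι] (A : ι → V) (s : Finset ι) (p : ι)
    (b : ι → ℝ) (u v : LinearMap.range (valueMap A s p)) :
    valueForm A s p b u v = ∑ k, b k * u.1 k * v.1 k := rfl

theorem valueForm_symm [Fintype ι] [DecidableEq ι] (A : ι → V) (s : Finset ι) (p : ι)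
    (b : ι → ℝ) (u v : LinearMap.range (valueMap A s p)) :
    valueForm A s p b u v = valueForm A s p b v u := by
  rw [valueForm_apply, valueForm_apply]
  exact Finset.sum_congr rfl fun k _ => by ring

theorem valueForm_sub_smul [Fintype ι] [DecidableEq ι] (A : ι → V) (s : Finset ι) (p : ι)
    (b c : ι → ℝ) (r : ℝ) :
    valueForm A s p (c - r • b) = valueForm A s p c - r • valueForm A s p b := by
  ext u v
  simp only [LinearMap.sub_apply, LinearMap.smul_apply, valueForm_apply, smul_eq_mul,
    Finset.mul_sum, ← Finset.sum_sub_distrib]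
  exact Finset.sum_congr rfl fun k _ => by simp; ring

/-- The form attached to a relation on `s` does not see the normalization of the linear forms. -/
theorem valueForm_rangeRestrict [Fintype ι] [DecidableEq ι] {A : ι → V} {ξ : Dual ℝ V}
    (hξ : ∀ k, ξ (A k) = 1) {s : Finset ι} {b : ι → ℝ} (hb : b ∈ relations A s) (p : ι)
    (v w : Dual ℝ V) :
    valueForm A s p b ((valueMap A s p).rangeRestrict v) ((valueMap A s p).rangeRestrict w) =
      w (∑ k, (b k * v (A k)) • A k) := by
  have h0 := sum_eq_zero_of_mem_relations hξ hb
  have hv := dual_sum_eq_zero hb v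
  have hw := dual_sum_eq_zero hb w
  have h1 : ∀ k, b k * ((valueMap A s p).rangeRestrict v).1 k *
        ((valueMap A s p).rangeRestrict w).1 k
      = b k * v (A k) * w (A k) - v (A p) * (b k * w (A k)) - w (A p) * (b k * v (A k))
        + v (A p) * w (A p) * b k := by
    intro k
    by_cases hk : k ∈ s
    · simp only [LinearMap.codRestrict_apply, valueMap_apply, hk, if_true]; ring
    · simp [hb.1 k hk]
  rw [valueForm_apply, Finset.sum_congr rfl fun k _ => h1 k, Finset.sum_add_distrib,
    Finset.sum_sub_distrib, Finset.sum_sub_distrib, ← Finset.mul_sum, ← Finset.mul_sum,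
    ← Finset.mul_sum, hv, hw, h0]
  simp [map_sum]

theorem valueForm_eq_zero_iff [Fintype ι] [DecidableEq ι] {A : ι → V} {ξ : Dual ℝ V}
    (hξ : ∀ k, ξ (A k) = 1) {s : Finset ι} {b : ι → ℝ} (hb : b ∈ relations A s) (p : ι)
    (v : Dual ℝ V) :
    valueForm A s p b ((valueMap A s p).rangeRestrict v) = 0 ↔
      ∑ k, (b k * v (A k)) • A k = 0 := by
  constructor
  · intro h
    rw [← Module.forall_dual_apply_eq_zero_iff ℝ]
    intro w
    rw [← valueForm_rangeRestrict hξ hb p, h, LinearMap.zero_apply]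
  · intro h
    ext u
    obtain ⟨w, rfl⟩ := LinearMap.surjective_rangeRestrict _ u
    rw [valueForm_rangeRestrict hξ hb p, h, map_zero, LinearMap.zero_apply]

theorem rangeRestrict_valueMap_eq_zero_iff [DecidableEq ι] {A : ι → V} {s : Finset ι} {p : ι}
    (hp : p ∈ s) (v : Dual ℝ V) :
    (valueMap A s p).rangeRestrict v = 0 ↔ ∃ c, ∀ k ∈ s, v (A k) = c := by
  constructor
  · intro h
    refine ⟨v (A p), fun k hk => ?_⟩
    have := congrFun (congrArg Subtype.val h) k
    simpa [valueMap_apply, hk, sub_eq_zero] using this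
  · rintro ⟨c, hc⟩
    ext k
    rw [LinearMap.codRestrict_apply, valueMap_apply]
    split_ifs with hk
    · rw [hc k hk, hc p hp]; simp
    · rfl

/-- A generic relation separates any two coordinates whose ratio to `b` is not the same for all
relations. -/
theorem exists_generic_relation [Fintype ι] (A : ι → V) (s : Finset ι) (b : ι → ℝ) :
    ∃ c ∈ relations A s, ∀ k l, c k * b l = c l * b k →
      ∀ d ∈ relations A s, d k * b l = d l * b k := by
  classical
  let S : ι × ι → Subspace ℝ (relations A s) := fun x =>
    LinearMap.ker ((b x.2 • LinearMap.proj x.1 - b x.1 • LinearMap.proj x.2 :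
      (ι → ℝ) →ₗ[ℝ] ℝ) ∘ₗ (relations A s).subtype)
  have hS : ∀ x (d : relations A s), d ∈ S x ↔ d.1 x.1 * b x.2 = d.1 x.2 * b x.1 := by
    intro x d
    simp [S, sub_eq_zero, mul_comm]
  let P : Finset (Subspace ℝ (relations A s)) := (Finset.univ.image S).filter fun p => p ≠ ⊤
  have hP : ⊤ ∉ P := by simp [P]
  have := Subspace.biUnion_ne_univ_of_top_notMem hP
  rw [Set.ne_univ_iff_exists_notMem] at this
  obtain ⟨c, hc⟩ := this
  refine ⟨c.1, c.2, fun k l hkl d hd => ?_⟩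
  have htop : S (k, l) = ⊤ := by
    by_contra hne
    apply hc
    rw [Set.mem_iUnion₂]
    exact ⟨S (k, l), by simp [P, hne], (hS (k, l) c).2 hkl⟩
  have : (⟨d, hd⟩ : relations A s) ∈ S (k, l) := htop ▸ Submodule.mem_top
  exact (hS (k, l) ⟨d, hd⟩).1 this

/-- The inductive step. Let `b` be a nondegenerate relation on `s`, not the only one up to scalars.
For a generic relation `c` the values `τ` of the ratios `c k / b k` partition `s` into classes `E`
of coordinates that are proportional on all relations. There are more indices than the dimension
of the space of linear forms modulo constants, so for some `τ` the radical of `c - τ b` is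
as small as possible: it consists of the linear forms that are constant off `E`. For this `τ` the
relation `c - τ b`, supported off `E`, is nondegenerate, and `b` is nondegenerate on the radical.
The latter forces `∑ k ∈ E, b k ≠ 0`: otherwise some linear form would be `1` on `E` and `0` at the
remaining points, and this form would be orthogonal to the radical. -/
theorem IsNondegenerate.exists_split [Fintype ι] {A : ι → V} {ξ : Dual ℝ V} (hξ : ∀ k, ξ (A k) = 1)
    [DecidableEq ι] {s : Finset ι} {b : ι → ℝ} (hb : IsNondegenerate A s b)
    (hne : ∃ c ∈ relations A s, ∀ m : ℝ, c ≠ m • b) :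
    ∃ E ⊆ s, E.Nonempty ∧ (s \ E).Nonempty ∧ (∃ b', IsNondegenerate A (s \ E) b') ∧
      ∑ k ∈ E, b k ≠ 0 ∧ ∀ d ∈ relations A s, ∃ m : ℝ, ∀ k ∈ E, d k = m * b k := by
  obtain ⟨c, hc, hgen⟩ := exists_generic_relation A s b
  have hsne : s.Nonempty := by
    rw [Finset.nonempty_iff_ne_empty]
    rintro rfl
    obtain ⟨d, hd, hd'⟩ := hne
    exact hd' 0 (by ext k; simpa using hd.1 k (by simp))
  obtain ⟨p, hp⟩ := hsne
  -- the linear forms modulo those that are constant on `s`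
  set W : Submodule ℝ (ι → ℝ) := LinearMap.range (valueMap A s p) with hW
  have hdimW : finrank ℝ W < s.card := by
    let ρ : W →ₗ[ℝ] (↥(s.erase p) → ℝ) :=
      (LinearMap.funLeft ℝ ℝ (fun k : ↥(s.erase p) => (k : ι))) ∘ₗ W.subtype
    have hρ : Function.Injective ρ := by
      rw [← LinearMap.ker_eq_bot, LinearMap.ker_eq_bot']
      rintro ⟨_, v, rfl⟩ hu
      ext k
      by_cases hk : k ∈ s
      · by_cases hkp : k = p
        · simp [valueMap_apply, hkp]
        · exact congrFun hu ⟨k, Finset.mem_erase.2 ⟨hkp, hk⟩⟩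
      · simp [valueMap_apply, hk]
    have h1 := LinearMap.finrank_le_finrank_of_injective hρ
    rw [finrank_fintype_fun_eq_card, Fintype.card_coe, Finset.card_erase_of_mem hp] at h1
    have := Finset.card_pos.2 ⟨p, hp⟩
    omega
  let T : Dual ℝ V →ₗ[ℝ] W := (valueMap A s p).rangeRestrict
  have hTs : ∀ u : W, ∃ v, T v = u := LinearMap.surjective_rangeRestrict _
  have hTval : ∀ v, (T v : ι → ℝ) = valueMap A s p v := fun v => rfl
  set B := valueForm A s p with hB
  have hnd : ∀ u, (∀ w, B b u w = 0) → u = 0 := by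
    intro u hu
    obtain ⟨v, rfl⟩ := hTs u
    rw [rangeRestrict_valueMap_eq_zero_iff hp]
    exact hb.const v ((valueForm_eq_zero_iff hξ hb.mem p v).1 (LinearMap.ext hu))
  obtain ⟨τ, hτ, hlt, hsemi⟩ := exists_pencil_root (B c) (B b)
    (valueForm_symm A s p c) (valueForm_symm A s p b) hnd s
    (fun k => c k / b k) hdimW
  set E := s.filter fun k => c k / b k = τ with hE
  have hEs : E ⊆ s := Finset.filter_subset _ _
  have hmemE : ∀ k ∈ s, (k ∈ E ↔ c k = τ * b k) := by
    intro k hk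
    rw [hE, Finset.mem_filter, div_eq_iff (hb.ne_zero k hk)]
    simp [hk]
  have hEne : E.Nonempty := by
    obtain ⟨k, hk, hk'⟩ := Finset.mem_image.1 hτ
    exact ⟨k, Finset.mem_filter.2 ⟨hk, hk'⟩⟩
  -- all relations are proportional to `b` on `E`
  have hprop : ∀ d ∈ relations A s, ∃ m : ℝ, ∀ k ∈ E, d k = m * b k := by
    intro d hd
    obtain ⟨l, hl⟩ := hEne
    have hl0 := hb.ne_zero l (hEs hl)
    refine ⟨d l / b l, fun k hk => ?_⟩
    have h1 : c k * b l = c l * b k := by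
      rw [(hmemE k (hEs hk)).1 hk, (hmemE l (hEs hl)).1 hl]; ring
    have h2 := hgen k l h1 d hd
    rw [div_mul_eq_mul_div, eq_div_iff hl0, h2]
  have hFne : (s \ E).Nonempty := by
    rw [Finset.nonempty_iff_ne_empty, Ne, Finset.sdiff_eq_empty_iff_subset]
    intro hsub
    obtain ⟨d, hd, hd'⟩ := hne
    obtain ⟨m, hm⟩ := hprop d hd
    refine hd' m ?_
    ext k
    by_cases hk : k ∈ s
    · simpa using hm k (hsub hk)
    · simp [hd.1 k hk, hb.mem.1 k hk]
  set b' : ι → ℝ := c - τ • b with hb'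
  have hb'k : ∀ k, b' k = c k - τ * b k := fun k => rfl
  have hb's : b' ∈ relations A s := Submodule.sub_mem _ hc (Submodule.smul_mem _ _ hb.mem)
  have hb'E : ∀ k ∈ E, b' k = 0 := fun k hk => by
    rw [hb'k, (hmemE k (hEs hk)).1 hk, sub_self]
  have hb'F : b' ∈ relations A (s \ E) := by
    refine ⟨fun k hk => ?_, hb's.2⟩
    rw [Finset.mem_sdiff, not_and_not_right] at hk
    by_cases hks : k ∈ s
    · exact hb'E k (hk hks)
    · exact hb's.1 k hks
  have hBb' : B c - τ • B b = B b' := (valueForm_sub_smul A s p b c τ).symm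
  rw [hBb'] at hlt hsemi
  set R := LinearMap.ker (B b') with hR
  have hmemR : ∀ v, T v ∈ R ↔ ∑ k, (b' k * v (A k)) • A k = 0 := by
    intro v
    rw [hR, LinearMap.mem_ker]
    exact valueForm_eq_zero_iff hξ hb's p v
  -- arbitrary values on `E` orthogonal to `b` extend by zero
  have hext : ∀ z : ι → ℝ, ∑ k ∈ E, b k * z k = 0 →
      ∃ v : Dual ℝ V, (∀ k ∈ E, v (A k) = z k) ∧ ∀ k ∈ s \ E, v (A k) = 0 := by
    intro z hz
    obtain ⟨v, hv⟩ := exists_dual_of_forall_relations A s (fun k => if k ∈ E then z k else 0) (by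
      intro d hd
      obtain ⟨m, hm⟩ := hprop d hd
      calc ∑ k, d k * (if k ∈ E then z k else 0) = ∑ k ∈ E, d k * z k := by
            simp [Finset.sum_ite_mem]
        _ = ∑ k ∈ E, m * (b k * z k) :=
            Finset.sum_congr rfl fun k hk => by rw [hm k hk]; ring
        _ = 0 := by rw [← Finset.mul_sum, hz, mul_zero])
    refine ⟨v, fun k hk => by simp [hv k (hEs hk), hk], fun k hk => ?_⟩
    rw [Finset.mem_sdiff] at hk
    simp [hv k hk.1, hk.2]
  have hvanish : ∀ v : Dual ℝ V, (∀ k ∈ s \ E, v (A k) = 0) → T v ∈ R := by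
    intro v hv
    rw [hmemR]
    refine Finset.sum_eq_zero fun k _ => ?_
    by_cases hk : k ∈ s \ E
    · rw [hv k hk]; simp
    · rw [hb'F.1 k hk]; simp
  obtain ⟨q, hq⟩ := hFne
  have hqs : q ∈ s := (Finset.mem_sdiff.1 hq).1
  -- the linear forms constant off `E` fill the radical
  let Z : Submodule ℝ W :=
    { carrier := {u | u ∈ R ∧ ∀ k ∈ s \ E, u.1 k = u.1 q}
      add_mem' := fun {u v} hu hv => ⟨R.add_mem hu.1 hv.1, fun k hk => by
        simp [hu.2 k hk, hv.2 k hk]⟩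
      zero_mem' := ⟨R.zero_mem, by simp⟩
      smul_mem' := fun r u hu => ⟨R.smul_mem r hu.1, fun k hk => by simp [hu.2 k hk]⟩ }
  have hZR : Z ≤ R := fun u hu => hu.1
  -- `hext` provides a linear form for each vector of values on `E` orthogonal to `b`
  have hdimZ : E.card ≤ finrank ℝ Z + 1 := by
    let σ : W →ₗ[ℝ] (E → ℝ) :=
      { toFun := fun u k => u.1 k - u.1 q
        map_add' := fun u v => by ext k; simp; ring
        map_smul' := fun r u => by ext k; simp; ring }
    let ψ : Dual ℝ (E → ℝ) := ∑ k : E, b k • LinearMap.proj k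
    have hψ : ∀ z, ψ z = ∑ k : E, b k * z k := fun z => by simp [ψ]
    have hsub : LinearMap.ker ψ ≤ Z.map σ := by
      intro z hz
      rw [LinearMap.mem_ker, hψ] at hz
      obtain ⟨v, hv, hv'⟩ := hext (fun k => if h : k ∈ E then z ⟨k, h⟩ else 0) (by
        rw [← Finset.sum_coe_sort E, ← hz]
        exact Finset.sum_congr rfl fun k _ => by simp)
      refine ⟨T v, ⟨hvanish v hv', fun k hk => ?_⟩, ?_⟩
      · have hks := (Finset.mem_sdiff.1 hk).1
        simp [hTval, valueMap_apply, hks, hqs, hv' k hk, hv' q hq]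
      · ext k
        have hks := hEs k.2
        simp [σ, hTval, valueMap_apply, hks, hqs, hv k k.2, hv' q hq]
    have h1 := Submodule.finrank_mono hsub
    have h2 := Submodule.finrank_map_le σ Z
    have h3 := LinearMap.finrank_range_add_finrank_ker ψ
    have h4 := Submodule.finrank_le (LinearMap.range ψ)
    rw [finrank_fintype_fun_eq_card, Fintype.card_coe] at h3
    rw [finrank_self] at h4
    omega
  have hZR' : Z = R := Submodule.eq_of_le_of_finrank_le hZR (Nat.le_of_lt_succ (hlt.trans_le hdimZ))
  have hdimR : E.card ≤ finrank ℝ R + 1 := hZR' ▸ hdimZ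
  have hconst : ∀ v : Dual ℝ V, T v ∈ R → ∀ k ∈ s \ E, v (A k) = v (A q) := by
    intro v hv k hk
    have h1 := (hZR'.symm ▸ hv : T v ∈ Z).2 k hk
    have hks := (Finset.mem_sdiff.1 hk).1
    simpa [hTval, valueMap_apply, hks, hqs] using h1
  refine ⟨E, hEs, hEne, ⟨q, hq⟩, ⟨b', hb'F, fun k hk => ?_, fun v hv =>
    ⟨v (A q), hconst v ((hmemR v).2 hv)⟩⟩, fun hsum => ?_, hprop⟩
  · rw [Finset.mem_sdiff] at hk
    intro h0
    rw [hb'k, sub_eq_zero] at h0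
    exact hk.2 ((hmemE k hk.1).2 h0)
  · -- otherwise the indicator of `E` is orthogonal to the radical
    obtain ⟨v, hv, hv'⟩ := hext (fun _ => 1) (by simpa using hsum)
    have hvR := hvanish v hv'
    have hu := hsemi hdimR (T v) hvR (by
      intro u hu
      obtain ⟨w, rfl⟩ := hTs u
      have hw := hconst w hu
      rw [hB, valueForm_rangeRestrict hξ hb.mem p]
      have hEw : ∑ k ∈ E, b k * w (A k) = 0 := by
        have h1 := dual_sum_eq_zero hb.mem (w - w (A q) • ξ)
        rw [← Finset.sum_subset (Finset.subset_univ E)] at h1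
        · simp only [LinearMap.sub_apply, LinearMap.smul_apply, hξ, smul_eq_mul, mul_one, mul_sub,
            Finset.sum_sub_distrib, ← Finset.sum_mul, hsum, zero_mul, sub_zero] at h1
          exact h1
        · intro k _ hk
          by_cases hks : k ∈ s
          · simp [hw k (Finset.mem_sdiff.2 ⟨hks, hk⟩), hξ]
          · simp [hb.mem.1 k hks]
      rw [map_sum, ← hEw, ← Finset.sum_subset (Finset.subset_univ E)]
      · exact Finset.sum_congr rfl fun k hk => by simp [hv k hk]
      · intro k _ hk
        by_cases hks : k ∈ s
        · simp [hv' k (Finset.mem_sdiff.2 ⟨hks, hk⟩)]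
        · simp [hb.mem.1 k hks])
    obtain ⟨k, hk⟩ := hEne
    obtain ⟨a, ha⟩ := (rangeRestrict_valueMap_eq_zero_iff hp v).1 hu
    have h2 := (ha k (hEs hk)).trans (ha q hqs).symm
    rw [hv k hk, hv' q hq] at h2
    exact one_ne_zero h2

end Config

/-! ### Chains of circuits -/

section Chain

variable {ι V : Type*} [AddCommGroup V] [Module ℝ V]

/-- The points `A k`, `k ∈ T`, together with `A p` form a circuit after `D` is divided out: up to
scalars there is a single affine relation between them modulo `D`, and none of its coefficients
vanishes. The coefficient of `A p` is minus the sum of the other ones. -/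
def IsCircuitModulo (A : ι → V) (p : ι) (D : Submodule ℝ V) (T : Finset ι) : Prop :=
  ∃ l : ι → ℝ, (∀ k ∈ T, l k ≠ 0) ∧ ∑ k ∈ T, l k ≠ 0 ∧ ∑ k ∈ T, l k • (A k - A p) ∈ D ∧
    ∀ μ : ι → ℝ, ∑ k ∈ T, μ k • (A k - A p) ∈ D → ∃ c : ℝ, ∀ k ∈ T, μ k = c * l k

/-- The direction of the affine span of `A p` and the points of `s` of level less than `j`. -/
def lowerSpan (A : ι → V) (p : ι) (s : Finset ι) (lev : ι → ℕ) (j : ℕ) : Submodule ℝ V :=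
  Submodule.span ℝ ((fun k => A k - A p) '' {k | k ∈ s ∧ k ≠ p ∧ lev k < j})

/-- A coordinate-free description of iterated circuits: the points of `s` other than the base point
`p` are sorted into `r` levels, and each level forms with `p` a circuit modulo the lower levels. -/
structure IsChain [DecidableEq ι] (A : ι → V) (p : ι) (s : Finset ι) (r : ℕ) (lev : ι → ℕ) :
    Prop where
  base_mem : p ∈ s
  lev_lt : ∀ k ∈ s, k ≠ p → lev k < r
  circuit : ∀ j < r, IsCircuitModulo A p (lowerSpan A p s lev j)
    (s.filter fun k => k ≠ p ∧ lev k = j)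

theorem span_image_eq_span_sub (A : ι → V) {p : ι} {s : Set ι} (hp : p ∈ s) :
    Submodule.span ℝ (A '' s) =
      Submodule.span ℝ {A p} ⊔ Submodule.span ℝ ((fun k => A k - A p) '' s) := by
  apply le_antisymm
  · rw [Submodule.span_le]
    rintro _ ⟨k, hk, rfl⟩
    rw [← add_sub_cancel (A p) (A k)]
    exact Submodule.add_mem_sup (Submodule.mem_span_singleton_self _)
      (Submodule.subset_span ⟨k, hk, rfl⟩)
  · rw [sup_le_iff, Submodule.span_singleton_le_iff_mem, Submodule.span_le]
    refine ⟨Submodule.subset_span ⟨p, hp, rfl⟩, ?_⟩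
    rintro _ ⟨k, hk, rfl⟩
    exact Submodule.sub_mem _ (Submodule.subset_span ⟨k, hk, rfl⟩)
      (Submodule.subset_span ⟨p, hp, rfl⟩)

theorem mem_span_sub_of_mem_span {A : ι → V} {ξ : Dual ℝ V} (hξ : ∀ k, ξ (A k) = 1) {p : ι}
    {s : Set ι} (hp : p ∈ s) {x : V} (hx : x ∈ Submodule.span ℝ (A '' s)) (hx0 : ξ x = 0) :
    x ∈ Submodule.span ℝ ((fun k => A k - A p) '' s) := by
  rw [span_image_eq_span_sub A hp] at hx
  obtain ⟨a, ha, y, hy, rfl⟩ := Submodule.mem_sup.1 hx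
  obtain ⟨c, rfl⟩ := Submodule.mem_span_singleton.1 ha
  have hy0 : ξ y = 0 := by
    have hle : Submodule.span ℝ ((fun k => A k - A p) '' s) ≤ LinearMap.ker ξ := by
      rw [Submodule.span_le]
      rintro _ ⟨k, -, rfl⟩
      simp [hξ]
    exact hle hy
  have hc : c = 0 := by simpa [hξ, hy0] using hx0
  simpa [hc] using hy

/-- Every point of a chain is of level less than `r` or equal to the base point. -/
theorem IsChain.lowerSpan_eq [DecidableEq ι] {A : ι → V} {p : ι} {s : Finset ι} {r : ℕ}
    {lev : ι → ℕ} (h : IsChain A p s r lev) {j : ℕ} (hj : r ≤ j) :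
    lowerSpan A p s lev j = Submodule.span ℝ ((fun k => A k - A p) '' (s : Set ι)) := by
  apply le_antisymm
  · exact Submodule.span_mono (Set.image_mono fun k hk => hk.1)
  · rw [Submodule.span_le]
    rintro _ ⟨k, hk, rfl⟩
    by_cases hkp : k = p
    · simp [hkp]
    · exact Submodule.subset_span ⟨k, ⟨hk, hkp, (h.lev_lt k hk hkp).trans_le hj⟩, rfl⟩

/-- Adding one more circuit on top of a chain. -/
theorem IsChain.union [DecidableEq ι] {A : ι → V} {p : ι} {s : Finset ι} {r : ℕ}
    {lev : ι → ℕ} (h : IsChain A p s r lev) {E : Finset ι} (hE : Disjoint s E)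
    (hc : IsCircuitModulo A p (Submodule.span ℝ ((fun k => A k - A p) '' (s : Set ι))) E) :
    IsChain A p (s ∪ E) (r + 1) (fun k => if k ∈ E then r else lev k) := by
  have hpE : p ∉ E := Finset.disjoint_left.1 hE h.base_mem
  have hlow : ∀ j ≤ r, lowerSpan A p (s ∪ E) (fun k => if k ∈ E then r else lev k) j =
      lowerSpan A p s lev j := by
    intro j hj
    unfold lowerSpan
    congr 2
    ext k
    simp only [Set.mem_ofPred_eq, Finset.mem_union]
    by_cases hk : k ∈ E
    · have hks : k ∉ s := Finset.disjoint_right.1 hE hk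
      simp only [hk, hks, if_true]
      constructor
      · rintro ⟨-, -, h'⟩; omega
      · rintro ⟨h', -⟩; exact h'.elim
    · simp [hk]
  refine ⟨Finset.mem_union_left _ h.base_mem, fun k hk hkp => ?_, fun j hj => ?_⟩
  · split_ifs with hkE
    · omega
    · have := h.lev_lt k ((Finset.mem_union.1 hk).resolve_right hkE) hkp
      omega
  · rw [hlow j (by omega)]
    rcases Nat.lt_succ_iff_lt_or_eq.1 hj with hj | rfl
    · convert h.circuit j hj using 1
      ext k
      simp only [Finset.mem_filter, Finset.mem_union]
      by_cases hk : k ∈ E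
      · have hks : k ∉ s := Finset.disjoint_right.1 hE hk
        simp only [hk, hks, if_true]
        constructor
        · rintro ⟨-, -, h'⟩; omega
        · rintro ⟨h', -⟩; exact h'.elim
      · simp [hk]
    · rw [h.lowerSpan_eq le_rfl]
      convert hc using 1
      ext k
      simp only [Finset.mem_filter, Finset.mem_union]
      by_cases hk : k ∈ E
      · have hkp : k ≠ p := fun h' => hpE (h' ▸ hk)
        simp [hk, hkp]
      · simp only [hk, if_false, or_false, iff_false]
        rintro ⟨hks, hkp, h'⟩
        have := h.lev_lt k hks hkp
        omega

theorem isChain_singleton [DecidableEq ι] (A : ι → V) (p : ι) :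
    IsChain A p {p} 0 fun _ => 0 :=
  ⟨by simp, fun k hk hkp => absurd (Finset.mem_singleton.1 hk) hkp, fun j hj => absurd hj (by simp)⟩

theorem sum_smul_sub (A : ι → V) (p : ι) (T : Finset ι) (l : ι → ℝ) :
    ∑ k ∈ T, l k • (A k - A p) = ∑ k ∈ T, l k • A k - (∑ k ∈ T, l k) • A p := by
  simp [smul_sub, Finset.sum_sub_distrib, Finset.sum_smul]

theorem sum_smul_mem_span [Fintype ι] {A : ι → V} {s : Finset ι} (c : ι → ℝ) :
    ∑ k ∈ s, c k • A k ∈ Submodule.span ℝ (A '' (s : Set ι)) :=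
  Submodule.sum_mem _ fun k hk => Submodule.smul_mem _ _ (Submodule.subset_span ⟨k, hk, rfl⟩)

/-- A class `E` of coordinates that are proportional on all relations forms a circuit modulo the
remaining points. -/
theorem isCircuitModulo_of_forall_relations [Fintype ι] [DecidableEq ι] {A : ι → V}
    {ξ : Dual ℝ V} (hξ : ∀ k, ξ (A k) = 1) {s s' E : Finset ι} {b : ι → ℝ}
    (hb : b ∈ relations A s) (hne : ∀ k ∈ s, b k ≠ 0) (hE : E ⊆ s) (hsum : ∑ k ∈ E, b k ≠ 0)
    (hprop : ∀ d ∈ relations A s, ∃ m : ℝ, ∀ k ∈ E, d k = m * b k)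
    {p : ι} (hp : p ∈ s') (hs' : s' ⊆ s \ E)
    (hspan : Submodule.span ℝ (A '' (s \ E : Finset ι)) ≤ Submodule.span ℝ (A '' (s' : Set ι))) :
    IsCircuitModulo A p (Submodule.span ℝ ((fun k => A k - A p) '' (s' : Set ι))) E := by
  refine ⟨b, fun k hk => hne k (hE hk), hsum, ?_, fun μ hμ => ?_⟩
  · apply mem_span_sub_of_mem_span hξ hp
    · rw [sum_smul_sub]
      refine Submodule.sub_mem _ (hspan ?_)
        (Submodule.smul_mem _ _ (Submodule.subset_span ⟨p, hp, rfl⟩))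
      have h1 : ∑ k ∈ s \ E, b k • A k + ∑ k ∈ E, b k • A k = 0 := by
        rw [Finset.sum_sdiff hE, ← hb.2]
        exact Finset.sum_subset (Finset.subset_univ s) fun k _ hk => by rw [hb.1 k hk, zero_smul]
      rw [← neg_eq_of_add_eq_zero_right h1]
      exact Submodule.neg_mem _ (sum_smul_mem_span b)
    · simp [map_sum, hξ]
  · have hmem : ∑ k ∈ E, μ k • A k ∈ Submodule.span ℝ (A '' (s' : Set ι)) := by
      have h1 := span_image_eq_span_sub A (s := (s' : Set ι)) hp
      have h2 : ∑ k ∈ E, μ k • (A k - A p) ∈ Submodule.span ℝ (A '' (s' : Set ι)) := by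
        rw [h1]; exact Submodule.mem_sup_right hμ
      rw [sum_smul_sub] at h2
      have h3 := Submodule.add_mem _ h2 (Submodule.smul_mem _ (∑ k ∈ E, μ k)
        (Submodule.subset_span ⟨p, hp, rfl⟩))
      rwa [sub_add_cancel] at h3
    rw [Submodule.mem_span_image_finset_iff_exists_fun'] at hmem
    obtain ⟨c, hc⟩ := hmem
    obtain ⟨m, hm⟩ := hprop (fun k => (if k ∈ E then μ k else 0) - if k ∈ s' then c k else 0) (by
      refine ⟨fun k hk => ?_, ?_⟩
      · have h1 : k ∉ E := fun h => hk (hE h)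
        have h2 : k ∉ s' := fun h => hk (Finset.mem_sdiff.1 (hs' h)).1
        simp [h1, h2]
      · simp [sub_smul, Finset.sum_sub_distrib, ite_smul, Finset.sum_ite_mem, hc])
    refine ⟨m, fun k hk => ?_⟩
    have h2 : k ∉ s' := fun h => (Finset.mem_sdiff.1 (hs' h)).2 hk
    simpa [hk, h2] using hm k hk

/-- A nondegenerate configuration contains a chain with the same span. -/
theorem IsNondegenerate.exists_chain [Fintype ι] [DecidableEq ι] {A : ι → V}
    {ξ : Dual ℝ V} (hξ : ∀ k, ξ (A k) = 1) {s : Finset ι} (hs : s.Nonempty) {b : ι → ℝ}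
    (hb : IsNondegenerate A s b) :
    ∃ p s' r lev, s' ⊆ s ∧ 0 < r ∧ IsChain A p s' r lev ∧
      Submodule.span ℝ (A '' (s : Set ι)) ≤ Submodule.span ℝ (A '' (s' : Set ι)) := by
  induction s using Finset.strongInduction generalizing b with
  | H s ih =>
    by_cases hne : ∃ c ∈ relations A s, ∀ m : ℝ, c ≠ m • b
    · obtain ⟨E, hEs, hE, hF, ⟨b', hb'⟩, hsum, hprop⟩ := hb.exists_split hξ hne
      obtain ⟨p, s', r, lev, hs', hr, hch, hspan⟩ :=
        ih (s \ E) (Finset.sdiff_ssubset hEs hE) hF hb'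
      have hdisj : Disjoint s' E := Finset.disjoint_of_subset_left hs' Finset.sdiff_disjoint
      refine ⟨p, s' ∪ E, r + 1, _, Finset.union_subset (hs'.trans Finset.sdiff_subset) hEs,
        r.succ_pos, hch.union hdisj (isCircuitModulo_of_forall_relations hξ hb.mem hb.ne_zero hEs
          hsum hprop hch.base_mem hs' hspan), ?_⟩
      rw [← Finset.sdiff_union_of_subset hEs, Finset.coe_union, Finset.coe_union, Set.image_union,
        Set.image_union, Submodule.span_union, Submodule.span_union]
      exact sup_le_sup_right hspan _
    · -- all relations are multiples of `b`: the whole configuration is a circuit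
      push Not at hne
      obtain ⟨p, hp⟩ := hs
      have hE : s.erase p ⊆ s := Finset.erase_subset _ _
      have hsd : s \ s.erase p = {p} := by
        rw [Finset.sdiff_erase_self hp]
      have hsum : ∑ k ∈ s.erase p, b k ≠ 0 := by
        have h1 := sum_eq_zero_of_mem_relations hξ hb.mem
        rw [← Finset.sum_subset (Finset.subset_univ s) fun k _ hk => hb.mem.1 k hk,
          ← Finset.add_sum_erase s b hp] at h1
        intro h0
        rw [h0, add_zero] at h1
        exact hb.ne_zero p hp h1
      have hcirc := isCircuitModulo_of_forall_relations hξ hb.mem hb.ne_zero hE hsum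
        (fun d hd => by
          obtain ⟨m, rfl⟩ := hne d hd
          exact ⟨m, fun k _ => rfl⟩)
        (s' := {p}) (Finset.mem_singleton_self p) hsd.ge (by rw [hsd])
      refine ⟨p, {p} ∪ s.erase p, 1, _, ?_, one_pos, (isChain_singleton A p).union (by simp) hcirc,
        ?_⟩
      · rw [← Finset.insert_eq, Finset.insert_erase hp]
      · rw [← Finset.insert_eq, Finset.insert_erase hp]

end Chain

/-! ### Circuits and relations -/

/-- A point carrying a nonzero coefficient of an affine relation is an affine combination of the
other ones. -/
theorem not_isPyramid_of_relation {ι : Type*} [Fintype ι] {n : ℕ} {A : ι → Fin (n + 1) → ℝ}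
    {l : ι → ℝ} (hl : ∀ k, l k ≠ 0) (hsum : ∑ k, l k = 0) (hrel : ∑ k, l k • A k = 0) :
    ¬ IsPyramid A := by
  classical
  rintro ⟨k, H, hH, hmem⟩
  refine hH.not_ge (affineSpan_le.2 ?_)
  have hsum' : ∑ i ∈ Finset.univ.erase k, (-(l i) / l k) = 1 := by
    rw [← Finset.add_sum_erase _ _ (Finset.mem_univ k)] at hsum
    rw [← Finset.sum_div, Finset.sum_neg_distrib, div_eq_one_iff_eq (hl k)]
    linarith
  have hk : A k = ∑ i ∈ Finset.univ.erase k, (-(l i) / l k) • A i := by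
    rw [← Finset.add_sum_erase _ _ (Finset.mem_univ k)] at hrel
    replace hrel := eq_neg_of_add_eq_zero_left hrel
    have h1 : (l k)⁻¹ • (l k • A k) = (l k)⁻¹ • -∑ i ∈ Finset.univ.erase k, l i • A i := by
      rw [hrel]
    rw [smul_smul, inv_mul_cancel₀ (hl k), one_smul] at h1
    rw [h1, ← Finset.sum_neg_distrib, Finset.smul_sum]
    refine Finset.sum_congr rfl fun i _ => ?_
    rw [← neg_smul, smul_smul]
    congr 1
    field_simp
  have hAk : A k ∈ H := by
    rw [hk, ← Finset.affineCombination_eq_linear_combination _ _ _ hsum']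
    have hsub : affineSpan ℝ (A '' {k}ᶜ) ≤ H := by
      rw [affineSpan_le]
      rintro _ ⟨i, hi, rfl⟩
      exact hmem i hi
    exact hsub (affineCombination_mem_affineSpan_image hsum' (fun i hi hi' => by simp_all) A)
  rintro _ ⟨i, rfl⟩
  by_cases hi : i = k
  · exact hi ▸ hAk
  · exact hmem i hi

theorem mem_span_of_not_isPyramid {ι : Type*} {n : ℕ} {A : ι → Fin (n + 1) → ℝ}
    (h : ¬ IsPyramid A) (k : ι) : A k ∈ Submodule.span ℝ (A '' {k}ᶜ) := by
  by_contra hk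
  refine h ⟨k, affineSpan ℝ (A '' {k}ᶜ), lt_of_le_of_ne
    (affineSpan_mono ℝ (Set.image_subset_range _ _)) fun heq => hk ?_, fun l hl =>
    subset_affineSpan ℝ _ ⟨l, hl, rfl⟩⟩
  have h1 : A k ∈ affineSpan ℝ (A '' {k}ᶜ) := by
    rw [heq]; exact subset_affineSpan ℝ _ ⟨k, rfl⟩
  exact affineSpan_subset_span h1

/-- The configuration with columns `(1, 0)` and `(1, a q)`. -/
def coneConfig {c m : ℕ} (a : Fin c → Fin m → ℝ) : Fin (c + 1) → Fin (m + 1) → ℝ :=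
  Fin.cons (Fin.cons 1 0) fun q => Fin.cons 1 (a q)

theorem sum_smul_coneConfig {c m : ℕ} (a : Fin c → Fin m → ℝ) (l : Fin (c + 1) → ℝ) :
    ∑ k, l k • coneConfig a k = Fin.cons (∑ k, l k) (∑ q, l q.succ • a q) := by
  rw [Fin.sum_univ_succ]
  ext i
  refine Fin.cases ?_ (fun i => ?_) i
  · simp [coneConfig, Fin.sum_univ_succ]
  · simp [coneConfig]

theorem isCircuit_coneConfig_iff {c m : ℕ} (a : Fin c → Fin m → ℝ) :
    IsCircuit (coneConfig a) ↔ c = m + 1 ∧ Submodule.span ℝ (Set.range a) = ⊤ ∧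
      ∃ l : Fin c → ℝ, (∀ q, l q ≠ 0) ∧ ∑ q, l q ≠ 0 ∧ ∑ q, l q • a q = 0 := by
  constructor
  · rintro ⟨⟨-, hspan⟩, hcard, hpyr⟩
    rw [Fintype.card_fin] at hcard
    refine ⟨by omega, ?_, ?_⟩
    · rw [eq_top_iff]
      rintro x -
      have hx : (Fin.cons 0 x : Fin (m + 1) → ℝ) ∈ Submodule.span ℝ (Set.range (coneConfig a)) :=
        hspan ▸ Submodule.mem_top
      rw [Submodule.mem_span_range_iff_exists_fun] at hx
      obtain ⟨l, hl⟩ := hx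
      rw [sum_smul_coneConfig, Fin.cons_inj] at hl
      rw [← hl.2]
      exact Submodule.sum_mem _ fun q _ =>
        Submodule.smul_mem _ _ (Submodule.subset_span ⟨q, rfl⟩)
    · have hdep : ¬ LinearIndependent ℝ (coneConfig a) := by
        intro hli
        have := hli.fintype_card_le_finrank
        rw [Fintype.card_fin, finrank_fintype_fun_eq_card, Fintype.card_fin] at this
        omega
      obtain ⟨l, hl, k₀, hk₀⟩ := Fintype.not_linearIndependent_iff.1 hdep
      have hfull : ∀ k, l k ≠ 0 := by
        intro k hk
        let f : ({k}ᶜ : Set (Fin (c + 1))) → Fin (m + 1) → ℝ := fun i => coneConfig a i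
        have hf : Submodule.span ℝ (Set.range f) = ⊤ := by
          rw [eq_top_iff, ← hspan, Submodule.span_le]
          have hr : Set.range f = coneConfig a '' {k}ᶜ := by
            rw [Set.image_eq_range]
          rw [hr]
          rintro _ ⟨i, rfl⟩
          by_cases hi : i = k
          · exact hi ▸ mem_span_of_not_isPyramid hpyr k
          · exact Submodule.subset_span ⟨i, hi, rfl⟩
        have hli : LinearIndependent ℝ f := by
          refine linearIndependent_of_top_le_span_of_card_eq_finrank hf.ge ?_
          rw [Fintype.card_compl_set, Fintype.card_fin, finrank_fintype_fun_eq_card,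
            Fintype.card_fin]
          simp; omega
        have hz := Fintype.linearIndependent_iff.1 hli (fun i => l i) (by
          have h1 : ∑ i ∈ Finset.univ.erase k, l i • coneConfig a i = 0 := by
            rw [← hl, ← Finset.add_sum_erase _ _ (Finset.mem_univ k), hk, zero_smul, zero_add]
          rw [← h1]
          exact (Finset.sum_subtype (Finset.univ.erase k) (fun i => by simp)
            (fun i => l i • coneConfig a i)).symm)
        have hk₀' : k₀ ≠ k := fun h => hk₀ (h ▸ hk)
        exact hk₀ (hz ⟨k₀, hk₀'⟩)
      rw [sum_smul_coneConfig] at hl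
      have h0 := congrFun hl 0
      rw [Fin.cons_zero, Fin.sum_univ_succ] at h0
      refine ⟨fun q => l q.succ, fun q => hfull _, fun h => hfull 0 ?_, ?_⟩
      · simpa [h] using h0
      · ext i
        exact congrFun hl i.succ
  · rintro ⟨rfl, hspan, l, hl, hsum, hrel⟩
    refine ⟨⟨⟨Pi.single 0 1, fun k => ?_⟩, ?_⟩, by simp, ?_⟩
    · rw [single_one_dotProduct]
      refine Fin.cases ?_ (fun q => ?_) k <;> simp [coneConfig]
    · rw [eq_top_iff]
      rintro x -
      have hx : (fun i => x (Fin.succ i)) ∈ Submodule.span ℝ (Set.range a) :=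
        hspan ▸ Submodule.mem_top
      rw [Submodule.mem_span_range_iff_exists_fun] at hx ⊢
      obtain ⟨μ, hμ⟩ := hx
      refine ⟨Fin.cons (x 0 - ∑ q, μ q) μ, ?_⟩
      rw [sum_smul_coneConfig, Fin.sum_univ_succ]
      ext i
      refine Fin.cases ?_ (fun i => ?_) i
      · simp
      · simpa using congrFun hμ i
    · have h1 : ∑ k, (Fin.cons (-∑ q, l q) l : Fin (m + 1 + 1) → ℝ) k = 0 := by
        simp [Fin.sum_univ_succ (n := m + 1)]
      refine not_isPyramid_of_relation (l := Fin.cons (-∑ q, l q) l) (fun k => ?_) h1 ?_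
      · refine Fin.cases ?_ (fun q => ?_) k
        · simpa using hsum
        · simpa using hl q
      · rw [sum_smul_coneConfig, h1]
        ext i
        refine Fin.cases ?_ (fun i => ?_) i
        · simp
        · simpa using congrFun hrel i

/-! ### From chains to upper diagonal forms -/

section ChainToForm

variable {ι V : Type*} [AddCommGroup V] [Module ℝ V] [DecidableEq ι]

/-- The points of level `j` of a chain. -/
def levelSet (p : ι) (s : Finset ι) (lev : ι → ℕ) (j : ℕ) : Finset ι :=
  s.filter fun k => k ≠ p ∧ lev k = j

theorem mem_levelSet {p : ι} {s : Finset ι} {lev : ι → ℕ} {j : ℕ} {k : ι} :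
    k ∈ levelSet p s lev j ↔ k ∈ s ∧ k ≠ p ∧ lev k = j := Finset.mem_filter

/-- In each level of a chain one point may be dropped so that the remaining differences with the
base point, together with the base point, form a basis of the span. -/
theorem IsChain.exists_basis {A : ι → V} {ξ : Dual ℝ V} (hξ : ∀ k, ξ (A k) = 1) {p : ι}
    {s : Finset ι} {r : ℕ} {lev : ι → ℕ} (h : IsChain A p s r lev)
    (hspan : Submodule.span ℝ (A '' (s : Set ι)) = ⊤) :
    ∃ (f : ∀ j : Fin r, Fin ((levelSet p s lev j).card - 1) → ι)
      (b : Basis (Option (Σ j : Fin r, Fin ((levelSet p s lev j).card - 1))) ℝ V),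
      (∀ (j : Fin r) i, f j i ∈ levelSet p s lev j) ∧ b none = A p ∧
        (∀ j i, b (some ⟨j, i⟩) = A (f j i) - A p) ∧
        ∀ N, lowerSpan A p s lev N ≤
          Submodule.span ℝ (b '' {x | ∃ (j : Fin r) (i : _), (j : ℕ) < N ∧ x = some ⟨j, i⟩}) := by
  have hcirc := fun j : Fin r => h.circuit j j.2
  choose l hl0 hlsum hlmem hluniq using hcirc
  have hT : ∀ j : Fin r, ∃ q, q ∈ levelSet p s lev j :=
    fun j => Finset.nonempty_of_sum_ne_zero (hlsum j)
  choose q hq using hT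
  have e : ∀ j : Fin r, Fin ((levelSet p s lev j).card - 1) ≃
      ↥((levelSet p s lev j).erase (q j)) := fun j =>
    ((levelSet p s lev j).erase (q j)).equivFinOfCardEq (Finset.card_erase_of_mem (hq j)) |>.symm
  let β : Option (Σ j : Fin r, Fin ((levelSet p s lev j).card - 1)) → V := fun x =>
    x.elim (A p) fun y => A (e y.1 y.2) - A p
  have hesum : ∀ (j : Fin r) (g : Fin ((levelSet p s lev j).card - 1) → ℝ),
      ∃ μ : ι → ℝ, μ (q j) = 0 ∧ (∀ i, μ (e j i) = g i) ∧
        ∑ k ∈ levelSet p s lev j, μ k • (A k - A p) = ∑ i, g i • (A (e j i) - A p) := by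
    intro j g
    let μ : ι → ℝ := fun k =>
      if hk : k ∈ (levelSet p s lev j).erase (q j) then g ((e j).symm ⟨k, hk⟩) else 0
    have hμ : ∀ i, μ (e j i) = g i := fun i => by
      have := (e j i).2
      simp only [μ]
      rw [dif_pos this]
      simp
    have hμq : μ (q j) = 0 := by simp [μ]
    refine ⟨μ, hμq, hμ, ?_⟩
    rw [← Finset.add_sum_erase _ _ (hq j), hμq, zero_smul, zero_add, ← Finset.sum_coe_sort,
      ← (e j).sum_comp]
    exact Finset.sum_congr rfl fun i _ => by rw [hμ]
  have hli : LinearIndependent ℝ β := by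
    rw [Fintype.linearIndependent_iff]
    intro g hg
    rw [Fintype.sum_option, Fintype.sum_sigma] at hg
    have hnone : g none = 0 := by
      have := congrArg ξ hg
      simpa [β, map_sum, hξ] using this
    -- downward induction on the level: once the coefficients of the higher levels vanish, those of
    -- level `j` form a relation modulo the lower levels, which is a multiple of the circuit relation
    -- and vanishes at the dropped point `q j`
    have hsome : ∀ j : Fin r, ∀ i, g (some ⟨j, i⟩) = 0 := by
      intro j
      induction j using WellFoundedGT.induction with
      | ind j ih =>
      obtain ⟨μ, hμq, hμ, hμsum⟩ := hesum j fun i => g (some ⟨j, i⟩)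
      obtain ⟨c, hc⟩ := hluniq j μ (by
        change ∑ k ∈ levelSet p s lev j, μ k • (A k - A p) ∈ _
        rw [hμsum]
        rw [hnone, zero_smul, zero_add, ← Finset.add_sum_erase _ _ (Finset.mem_univ j)] at hg
        replace hg := eq_neg_of_add_eq_zero_left hg
        change ∑ i, g (some ⟨j, i⟩) • β (some ⟨j, i⟩) ∈ _
        rw [hg]
        refine Submodule.neg_mem _ (Submodule.sum_mem _ fun j' hj' => ?_)
        refine Submodule.sum_mem _ fun i _ => ?_
        rcases lt_or_gt_of_ne (Finset.ne_of_mem_erase hj') with hlt | hgt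
        · refine Submodule.smul_mem _ _ (Submodule.subset_span ⟨e j' i, ?_, rfl⟩)
          obtain ⟨h1, h2, h3⟩ := mem_levelSet.1 (Finset.mem_of_mem_erase (e j' i).2)
          exact ⟨h1, h2, h3.trans_lt hlt⟩
        · rw [ih j' hgt, zero_smul]
          exact Submodule.zero_mem _)
      have hc0 : c = 0 := by
        have := hc (q j) (hq j)
        rw [hμq] at this
        exact (mul_eq_zero.1 this.symm).resolve_right (hl0 j _ (hq j))
      intro i
      rw [← hμ i, hc _ (Finset.mem_of_mem_erase (e j i).2), hc0, zero_mul]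
    rintro (_ | ⟨j, i⟩)
    · exact hnone
    · exact hsome j i
  let S : ℕ → Submodule ℝ V := fun N =>
    Submodule.span ℝ (β '' {x | ∃ (j : Fin r) (i : _), (j : ℕ) < N ∧ x = some ⟨j, i⟩})
  have hlev : ∀ N, lowerSpan A p s lev N ≤ S N := by
    intro N
    induction N using Nat.strong_induction_on with
    | h N ih =>
    rw [lowerSpan, Submodule.span_le]
    rintro _ ⟨k, ⟨hk, hkp, hkN⟩, rfl⟩
    have hkr : lev k < r := h.lev_lt k hk hkp
    have hmono : S (lev k) ≤ S N :=
      Submodule.span_mono (Set.image_mono fun x ⟨j, i, hj, hx⟩ => ⟨j, i, hj.trans hkN, hx⟩)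
    have hrest : ∀ x ∈ (levelSet p s lev (lev k)).erase (q ⟨lev k, hkr⟩), A x - A p ∈ S N := by
      intro x hx
      refine Submodule.subset_span
        ⟨some ⟨⟨lev k, hkr⟩, (e ⟨lev k, hkr⟩).symm ⟨x, hx⟩⟩, ⟨_, _, hkN, rfl⟩, ?_⟩
      simp [β]
    by_cases hkq : k = q ⟨lev k, hkr⟩
    · have h1 := hmono (ih _ hkN (hlmem ⟨lev k, hkr⟩))
      change ∑ x ∈ levelSet p s lev (lev k), l ⟨lev k, hkr⟩ x • (A x - A p) ∈ _ at h1
      rw [← Finset.add_sum_erase _ _ (hq ⟨lev k, hkr⟩)] at h1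
      have h2 := (Submodule.add_mem_iff_left _ (Submodule.sum_mem _ fun x hx =>
        Submodule.smul_mem _ _ (hrest x hx))).1 h1
      have h3 := (Submodule.smul_mem_iff _ (hl0 _ _ (hq ⟨lev k, hkr⟩))).1 h2
      rwa [← hkq] at h3
    · exact hrest k (Finset.mem_erase.2 ⟨hkq, mem_levelSet.2 ⟨hk, hkp, rfl⟩⟩)
  have htop : ⊤ ≤ Submodule.span ℝ (Set.range β) := by
    have hp : A p ∈ Submodule.span ℝ (Set.range β) := Submodule.subset_span ⟨none, rfl⟩
    rw [← hspan, span_image_eq_span_sub A h.base_mem, sup_le_iff,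
      Submodule.span_singleton_le_iff_mem, ← h.lowerSpan_eq le_rfl]
    exact ⟨hp, (hlev r).trans (Submodule.span_mono (Set.image_subset_range _ _))⟩
  refine ⟨fun j i => e j i, Basis.mk hli htop, fun j i => Finset.mem_of_mem_erase (e j i).2,
    by simp [β], fun j i => by simp [β], fun N => ?_⟩
  rw [Basis.coe_mk]
  exact hlev N

/-- The points of a chain, listed by levels after the base point. -/
def IsChain.levelEquiv {A : ι → V} {p : ι} {s : Finset ι} {r : ℕ} {lev : ι → ℕ}
    (h : IsChain A p s r lev) :
    Option (Σ j : Fin r, Fin (levelSet p s lev j).card) ≃ (s : Set ι) :=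
  (Equiv.optionCongr
    ((Equiv.sigmaCongrRight fun j : Fin r => (levelSet p s lev j).equivFin.symm).trans
      { toFun := fun x => (⟨⟨x.2.1, (mem_levelSet.1 x.2.2).1⟩, fun h' =>
          (mem_levelSet.1 x.2.2).2.1 (congrArg Subtype.val h')⟩ :
            {x : (s : Set ι) // x ≠ ⟨p, h.base_mem⟩})
        invFun := fun x => ⟨⟨lev x.1.1, h.lev_lt _ x.1.2 fun h' => x.2 (Subtype.ext h')⟩,
          ⟨x.1.1, mem_levelSet.2 ⟨x.1.2, fun h' => x.2 (Subtype.ext h'), rfl⟩⟩⟩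
        left_inv := by
          rintro ⟨⟨j, hj⟩, k, hk⟩
          obtain ⟨h1, h2, h3⟩ := mem_levelSet.1 hk
          dsimp only at h3
          subst h3
          rfl
        right_inv := fun x => rfl })).trans
    (Equiv.optionSubtypeNe _)

theorem IsChain.levelEquiv_none {A : ι → V} {p : ι} {s : Finset ι} {r : ℕ} {lev : ι → ℕ}
    (h : IsChain A p s r lev) : (h.levelEquiv none : ι) = p := rfl

theorem IsChain.levelEquiv_some {A : ι → V} {p : ι} {s : Finset ι} {r : ℕ} {lev : ι → ℕ}
    (h : IsChain A p s r lev) (j : Fin r) (q : Fin (levelSet p s lev j).card) :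
    (h.levelEquiv (some ⟨j, q⟩) : ι) = (levelSet p s lev j).equivFin.symm q := rfl

/-- In the basis of differences with the base point, the matrix of a spanning chain has upper
diagonal form, and its diagonal blocks are circuits. -/
theorem IsChain.isIteratedCircuit {n : ℕ} {A : ι → Fin (n + 1) → ℝ}
    {ξ : Dual ℝ (Fin (n + 1) → ℝ)} (hξ : ∀ k, ξ (A k) = 1) {p : ι}
    {s : Finset ι} {r : ℕ} {lev : ι → ℕ} (h : IsChain A p s r lev) (hr : 0 < r)
    (hspan : Submodule.span ℝ (A '' (s : Set ι)) = ⊤) :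
    IsIteratedCircuit fun k : (s : Set ι) => A k := by
  obtain ⟨f, b, hf, hb0, hb, hlow⟩ := h.exists_basis hξ hspan
  have hcard : Fintype.card (Σ j : Fin r, Fin ((levelSet p s lev j).card - 1)) = n := by
    have h1 := Module.finrank_eq_card_basis b
    rw [finrank_fintype_fun_eq_card, Fintype.card_fin, Fintype.card_option] at h1
    omega
  let re := Fintype.equivFinOfCardEq hcard
  let b' : Basis (Fin (n + 1)) ℝ (Fin (n + 1) → ℝ) :=
    b.reindex ((Equiv.optionCongr re).trans (finSuccEquiv n).symm)
  let g : GL (Fin (n + 1)) ℝ :=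
    ⟨LinearMap.toMatrix' b'.equivFun.toLinearMap, LinearMap.toMatrix' b'.equivFun.symm.toLinearMap,
      by rw [← LinearMap.toMatrix'_comp]; simp, by rw [← LinearMap.toMatrix'_comp]; simp⟩
  have hg : ∀ x, g.val *ᵥ x = b'.equivFun x := fun x => LinearMap.toMatrix'_mulVec _ x
  have hg0 : ∀ x, (g.val *ᵥ x) 0 = b.coord none x := by
    intro x
    rw [hg, Basis.equivFun_apply, Basis.repr_reindex_apply]
    simp [← Equiv.optionCongr_symm]
  have hgs : ∀ x y, (g.val *ᵥ x) (re y).succ = b.coord (some y) x := by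
    intro x y
    rw [hg, Basis.equivFun_apply, Basis.repr_reindex_apply]
    simp [← Equiv.optionCongr_symm]
  have hcoord : ∀ y z, b.coord (some y) (b (some z)) = if z = y then 1 else 0 := by
    intro y z
    rw [Basis.coord_apply, Basis.repr_self, Finsupp.single_apply]
    simp
  have hcoord0 : ∀ y, b.coord (some y) (A p) = 0 := by
    intro y
    rw [← hb0, Basis.coord_apply, Basis.repr_self, Finsupp.single_apply]
    simp
  have htop : b.coord none = ξ := by
    refine b.ext fun x => ?_
    rw [Basis.coord_apply, Basis.repr_self, Finsupp.single_apply]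
    rcases x with _ | ⟨j, i⟩
    · simp [hb0, hξ]
    · simp [hb, hξ]
  -- the coordinates of a level vanish on all lower levels
  have hvan : ∀ (j : Fin r) i, ∀ x ∈ lowerSpan A p s lev j, b.coord (some ⟨j, i⟩) x = 0 := by
    intro j i
    have hle : lowerSpan A p s lev j ≤ LinearMap.ker (b.coord (some ⟨j, i⟩)) := by
      refine (hlow j).trans ?_
      rw [Submodule.span_le]
      rintro _ ⟨_, ⟨j', i', hj', rfl⟩, rfl⟩
      change b.coord _ (b _) = 0
      rw [hcoord, if_neg]
      intro h'
      rw [Sigma.mk.inj_iff] at h'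
      rw [h'.1] at hj'
      exact lt_irrefl _ hj'
    exact hle
  have hdiag : ∀ j : Fin r, IsCircuit (coneConfig fun (q : Fin (levelSet p s lev j).card)
      (m : Fin ((levelSet p s lev j).card - 1)) =>
        (g.val *ᵥ A (h.levelEquiv (some ⟨j, q⟩))) (re ⟨j, m⟩).succ) := by
    intro j
    obtain ⟨l, hl0, hlsum, hlmem, -⟩ := h.circuit j j.2
    change ∀ k ∈ levelSet p s lev j, l k ≠ 0 at hl0
    change ∑ k ∈ levelSet p s lev j, l k ≠ 0 at hlsum
    change ∑ k ∈ levelSet p s lev j, l k • (A k - A p) ∈ _ at hlmem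
    have hpos : 0 < (levelSet p s lev j).card :=
      Finset.card_pos.2 (Finset.nonempty_of_sum_ne_zero hlsum)
    refine (isCircuit_coneConfig_iff _).2 ⟨by omega, ?_, ?_⟩
    · rw [eq_top_iff, ← (Pi.basisFun ℝ _).span_eq, Submodule.span_le]
      rintro _ ⟨m, rfl⟩
      refine Submodule.subset_span ⟨(levelSet p s lev j).equivFin ⟨f j m, hf j m⟩, ?_⟩
      ext m'
      simp only [h.levelEquiv_some, hgs, Equiv.symm_apply_apply]
      have h1 : A (f j m) = b (some ⟨j, m⟩) + A p := by rw [hb, sub_add_cancel]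
      rw [h1, map_add, hcoord, hcoord0, add_zero, Pi.basisFun_apply, Pi.single_apply]
      simp [eq_comm]
    · have hsum : ∀ F : ι → ℝ, ∑ q, F ((levelSet p s lev j).equivFin.symm q) =
          ∑ k ∈ levelSet p s lev j, F k := by
        intro F
        rw [← Finset.sum_coe_sort (levelSet p s lev j)]
        exact (levelSet p s lev j).equivFin.symm.sum_comp fun k => F k
      refine ⟨fun q => l ((levelSet p s lev j).equivFin.symm q), fun q => hl0 _ (Subtype.prop _),
        by rwa [hsum], ?_⟩
      ext m
      rw [Finset.sum_apply]
      simp only [Pi.smul_apply, h.levelEquiv_some, hgs, smul_eq_mul, Pi.zero_apply]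
      rw [hsum fun k => l k * b.coord (some ⟨j, m⟩) (A k), ← hvan j m _ hlmem, map_sum]
      exact Finset.sum_congr rfl fun k _ => by simp only [map_smul, map_sub, hcoord0, sub_zero,
        smul_eq_mul]
  refine ⟨{ blocks := r
            rows := fun j => (levelSet p s lev j).card - 1
            cols := fun j => (levelSet p s lev j).card
            rowEquiv := re
            colEquiv := h.levelEquiv
            g := g
            top_row := fun k => by rw [hg0, htop, hξ]
            first_col := fun i => ?_
            lower := fun i j m q hji => ?_ }, hr, hdiag⟩
  · rw [h.levelEquiv_none, ← re.apply_symm_apply i, hgs, hcoord0]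
  · rw [h.levelEquiv_some, hgs]
    set k := ((levelSet p s lev j).equivFin.symm q : ι) with hk
    obtain ⟨h1, h2, h3⟩ := mem_levelSet.1 ((levelSet p s lev j).equivFin.symm q).2
    have h4 := hvan i m (A k - A p) (Submodule.subset_span ⟨k, ⟨h1, h2, h3.trans_lt hji⟩, rfl⟩)
    rwa [map_sub, hcoord0, sub_zero] at h4

end ChainToForm

/-! ### From upper diagonal forms to chains -/

theorem exists_eq_smul_of_relation {c m : ℕ} {a : Fin c → Fin m → ℝ} (hc : c = m + 1)
    (hspan : Submodule.span ℝ (Set.range a) = ⊤) {l μ : Fin c → ℝ} (hl : l ≠ 0)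
    (hl' : ∑ q, l q • a q = 0) (hμ : ∑ q, μ q • a q = 0) : ∃ t : ℝ, μ = t • l := by
  have hsurj : LinearMap.range (Fintype.linearCombination ℝ a) = ⊤ := by
    rw [Fintype.range_linearCombination, hspan]
  have hdim := LinearMap.finrank_range_add_finrank_ker (Fintype.linearCombination ℝ a)
  rw [hsurj, finrank_top, finrank_fintype_fun_eq_card, finrank_fintype_fun_eq_card,
    Fintype.card_fin, Fintype.card_fin] at hdim
  have hker : finrank ℝ (LinearMap.ker (Fintype.linearCombination ℝ a)) = 1 := by omega
  have hmem : ∀ x : Fin c → ℝ, ∑ q, x q • a q = 0 →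
      x ∈ LinearMap.ker (Fintype.linearCombination ℝ a) := fun x hx => by
    rw [LinearMap.mem_ker, Fintype.linearCombination_apply, hx]
  obtain ⟨t, ht⟩ := (finrank_eq_one_iff_of_nonzero' (⟨l, hmem l hl'⟩ :
    LinearMap.ker (Fintype.linearCombination ℝ a)) (fun h => hl (congrArg Subtype.val h))).1 hker
    ⟨μ, hmem μ hμ⟩
  exact ⟨t, (congrArg Subtype.val ht).symm⟩

theorem UpperDiagonalForm.exists_isChain {ι : Type*} [Fintype ι] [DecidableEq ι] {n : ℕ}
    {A : ι → Fin (n + 1) → ℝ} (F : UpperDiagonalForm A)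
    (hF : ∀ j, IsCircuit (F.diagonalConfig j)) :
    ∃ p lev, IsChain A p Finset.univ F.blocks lev ∧ Submodule.span ℝ (Set.range A) = ⊤ := by
  set p := F.colEquiv none with hp
  let lev : ι → ℕ := fun k => (F.colEquiv.symm k).elim 0 fun x => x.1
  have hlev : ∀ j q, lev (F.colEquiv (some ⟨j, q⟩)) = j := fun j q => by simp [lev]
  have hne : ∀ x, F.colEquiv (some x) ≠ p := fun x => by simp [hp]
  have hcases : ∀ k, k ≠ p → ∃ j q, k = F.colEquiv (some ⟨j, q⟩) := by
    intro k hk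
    obtain ⟨_ | ⟨j, q⟩, rfl⟩ := F.colEquiv.surjective k
    · exact absurd rfl hk
    · exact ⟨j, q, rfl⟩
  have hinj : ∀ j, Function.Injective fun q => F.colEquiv (some ⟨j, q⟩) := by
    intro j q q' h
    simpa using h
  let c : (Fin (n + 1) → ℝ) →ₗ[ℝ] (Fin (n + 1) → ℝ) := F.g.val.mulVecLin
  have hc : ∀ x, F.g.val *ᵥ x = c x := fun x => rfl
  have hcinj : ∀ x, c x = 0 → x = 0 := by
    intro x hx
    have : (F.g⁻¹).val *ᵥ (F.g.val *ᵥ x) = 0 := by rw [hc, hx, Matrix.mulVec_zero]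
    rwa [Matrix.mulVec_mulVec, ← Units.val_mul, inv_mul_cancel, Units.val_one,
      Matrix.one_mulVec] at this
  have htop : ∀ k, c (A k) 0 = 1 := F.top_row
  have hfirst : ∀ i : Fin n, c (A p) i.succ = 0 := F.first_col
  have hlow : ∀ i j r q, j < i → c (A (F.colEquiv (some ⟨j, q⟩))) (F.rowEquiv ⟨i, r⟩).succ = 0 :=
    F.lower
  choose hcard hspan l hl0 hlsum hlrel using fun j => (isCircuit_coneConfig_iff
    fun q r => c (A (F.colEquiv (some ⟨j, q⟩))) (F.rowEquiv ⟨j, r⟩).succ).1 (hF j)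
  have hmono : ∀ m m', m ≤ m' → lowerSpan A p Finset.univ lev m ≤
      lowerSpan A p Finset.univ lev m' := fun m m' hm =>
    Submodule.span_mono (Set.image_mono fun k hk => ⟨hk.1, hk.2.1, hk.2.2.trans_le hm⟩)
  have hblock : ∀ (j : Fin F.blocks) (f : ι → ℝ) r,
      c (∑ q, f (F.colEquiv (some ⟨j, q⟩)) • (A (F.colEquiv (some ⟨j, q⟩)) - A p)) (Fin.succ r) =
        ∑ q, f (F.colEquiv (some ⟨j, q⟩)) * c (A (F.colEquiv (some ⟨j, q⟩))) (Fin.succ r) := by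
    intro j f r
    rw [map_sum, Finset.sum_apply]
    exact Finset.sum_congr rfl fun q _ => by simp [hfirst]
  have hblock0 : ∀ (j : Fin F.blocks) (f : ι → ℝ),
      c (∑ q, f (F.colEquiv (some ⟨j, q⟩)) • (A (F.colEquiv (some ⟨j, q⟩)) - A p)) 0 = 0 := by
    intro j f
    rw [map_sum, Finset.sum_apply]
    exact Finset.sum_eq_zero fun q _ => by simp [htop]
  -- vectors whose coordinates vanish at the top and from block `m` on
  have hspanlow : ∀ m ≤ F.blocks, ∀ x, c x 0 = 0 →
      (∀ i : Fin F.blocks, m ≤ i → ∀ r, c x (F.rowEquiv ⟨i, r⟩).succ = 0) →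
      x ∈ lowerSpan A p Finset.univ lev m := by
    intro m
    induction m with
    | zero =>
      intro _ x hx0 hx
      have : x = 0 := by
        apply hcinj
        ext i
        refine Fin.cases hx0 (fun i => ?_) i
        obtain ⟨⟨j, r⟩, rfl⟩ := F.rowEquiv.surjective i
        exact hx j (Nat.zero_le _) r
      rw [this]
      exact Submodule.zero_mem _
    | succ m ih =>
      intro hm x hx0 hx
      set j : Fin F.blocks := ⟨m, hm⟩ with hj
      have hx' : (fun r => c x (F.rowEquiv ⟨j, r⟩).succ) ∈ Submodule.span ℝ (Set.range
          fun q r => c (A (F.colEquiv (some ⟨j, q⟩))) (F.rowEquiv ⟨j, r⟩).succ) :=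
        hspan j ▸ Submodule.mem_top
      rw [Submodule.mem_span_range_iff_exists_fun] at hx'
      obtain ⟨d, hd⟩ := hx'
      obtain ⟨f, hf⟩ : ∃ f : ι → ℝ, ∀ q, f (F.colEquiv (some ⟨j, q⟩)) = d q :=
        ⟨Function.extend (fun q => F.colEquiv (some ⟨j, q⟩)) d 0,
          fun q => (hinj j).extend_apply _ _ q⟩
      set y := ∑ q, f (F.colEquiv (some ⟨j, q⟩)) • (A (F.colEquiv (some ⟨j, q⟩)) - A p) with hy
      have hylow : y ∈ lowerSpan A p Finset.univ lev (m + 1) :=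
        Submodule.sum_mem _ fun q _ => Submodule.smul_mem _ _ (Submodule.subset_span
          ⟨_, ⟨Finset.mem_univ _, hne _, by rw [hlev, hj]; exact Nat.lt_succ_self m⟩, rfl⟩)
      rw [← sub_add_cancel x y]
      refine Submodule.add_mem _ (hmono m _ (Nat.le_succ m) (ih (by omega) _ ?_ ?_)) hylow
      · rw [map_sub, Pi.sub_apply, hx0, hy, hblock0, sub_zero]
      · intro i hi r
        rw [map_sub, Pi.sub_apply, hy, hblock, sub_eq_zero]
        rcases Nat.eq_or_lt_of_le hi with hi | hi
        · obtain rfl : j = i := Fin.ext hi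
          have := congrFun hd r
          simp only [Finset.sum_apply, Pi.smul_apply, smul_eq_mul] at this
          rw [← this]
          exact Finset.sum_congr rfl fun q _ => by rw [hf]
        · rw [hx i hi r]
          exact (Finset.sum_eq_zero fun q _ => by rw [hlow i j r q hi, mul_zero]).symm
  refine ⟨p, lev, ⟨Finset.mem_univ _, fun k _ hk => ?_, fun j hj => ?_⟩, ?_⟩
  · obtain ⟨j, q, rfl⟩ := hcases k hk
    rw [hlev]
    exact j.2
  · set j' : Fin F.blocks := ⟨j, hj⟩ with hj'
    have hfilter : (Finset.univ.filter fun k => k ≠ p ∧ lev k = j) =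
        Finset.univ.map ⟨fun q => F.colEquiv (some ⟨j', q⟩), hinj j'⟩ := by
      ext k
      simp only [Finset.mem_filter, Finset.mem_univ, true_and, Finset.mem_map,
        Function.Embedding.coeFn_mk]
      constructor
      · rintro ⟨hk, hkj⟩
        obtain ⟨i, q, rfl⟩ := hcases k hk
        rw [hlev] at hkj
        obtain rfl : i = j' := Fin.ext hkj
        exact ⟨q, rfl⟩
      · rintro ⟨q, rfl⟩
        exact ⟨hne _, hlev _ _⟩
    obtain ⟨f, hf⟩ : ∃ f : ι → ℝ, ∀ q, f (F.colEquiv (some ⟨j', q⟩)) = l j' q :=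
      ⟨Function.extend (fun q => F.colEquiv (some ⟨j', q⟩)) (l j') 0,
        fun q => (hinj j').extend_apply _ _ q⟩
    refine ⟨f, ?_, ?_, ?_, fun μ hμ => ?_⟩
    · intro k hk
      rw [hfilter, Finset.mem_map] at hk
      obtain ⟨q, -, rfl⟩ := hk
      exact (hf q).trans_ne (hl0 j' q)
    · rw [hfilter, Finset.sum_map]
      simpa only [Function.Embedding.coeFn_mk, hf] using hlsum j'
    · rw [hfilter, Finset.sum_map]
      simp only [Function.Embedding.coeFn_mk]
      refine hspanlow j hj.le _ (hblock0 j' f) fun i hi r => ?_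
      rw [hblock]
      rcases Nat.eq_or_lt_of_le hi with hi | hi
      · obtain rfl : j' = i := Fin.ext hi
        have := congrFun (hlrel j') r
        simp only [Finset.sum_apply, Pi.smul_apply, smul_eq_mul] at this
        simpa only [hf, Pi.zero_apply] using this
      · exact Finset.sum_eq_zero fun q _ => by rw [hlow i j' r q hi, mul_zero]
    · rw [hfilter, Finset.sum_map] at hμ
      simp only [Function.Embedding.coeFn_mk] at hμ
      have hle : ∀ r, lowerSpan A p Finset.univ lev j ≤
          LinearMap.ker (LinearMap.proj (F.rowEquiv ⟨j', r⟩).succ ∘ₗ c) := by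
        intro r
        rw [lowerSpan, Submodule.span_le]
        rintro _ ⟨k, ⟨-, hkp, hk⟩, rfl⟩
        obtain ⟨i, q, rfl⟩ := hcases k hkp
        rw [hlev] at hk
        change c (_ - _) _ = 0
        rw [map_sub, Pi.sub_apply, hfirst, hlow j' i r q hk, sub_zero]
      obtain ⟨t, ht⟩ := exists_eq_smul_of_relation (hcard j') (hspan j')
        (l := l j') (μ := fun q => μ (F.colEquiv (some ⟨j', q⟩)))
        (fun h => hlsum j' (by simp [h])) (hlrel j') (by
          ext r
          have h1 : c _ _ = 0 := hle r hμ
          rw [hblock] at h1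
          simpa only [Finset.sum_apply, Pi.smul_apply, smul_eq_mul, Pi.zero_apply] using h1)
      refine ⟨t, fun k hk => ?_⟩
      rw [hfilter, Finset.mem_map] at hk
      obtain ⟨q, -, rfl⟩ := hk
      have := congrFun ht q
      simpa only [Function.Embedding.coeFn_mk, hf, Pi.smul_apply, smul_eq_mul] using this
  · rw [eq_top_iff]
    rintro x -
    have h1 := hspanlow F.blocks le_rfl (x - c x 0 • A p) (by simp [htop])
      (fun i hi => absurd i.2 (by omega))
    have h2 : lowerSpan A p Finset.univ lev F.blocks ≤ Submodule.span ℝ (Set.range A) := by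
      rw [lowerSpan, Submodule.span_le]
      rintro _ ⟨k, -, rfl⟩
      exact Submodule.sub_mem _ (Submodule.subset_span ⟨k, rfl⟩) (Submodule.subset_span ⟨p, rfl⟩)
    have h3 := Submodule.add_mem _ (h2 h1) (Submodule.smul_mem _ (c x 0)
      (Submodule.subset_span (R := ℝ) (Set.mem_range_self (f := A) p)))
    rwa [sub_add_cancel] at h3

/-! ### Chains are nondegenerate -/

/-- If `M₁` has no radical on the kernel of the symmetric form `M₀`, then a small perturbation of
`M₀` in the direction `M₁` is nondegenerate: a limit of unit vectors in the kernels would be a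
radical vector. -/
theorem eventually_ker_sub_smul_eq_bot {E : Type*} [NormedAddCommGroup E] [NormedSpace ℝ E]
    [FiniteDimensional ℝ E] (M₀ M₁ : E →ₗ[ℝ] E →ₗ[ℝ] ℝ) (h₀ : ∀ u v, M₀ u v = M₀ v u)
    (h : ∀ u, M₀ u = 0 → (∀ w, M₀ w = 0 → M₁ u w = 0) → u = 0) :
    ∀ᶠ ε : ℝ in 𝓝[≠] 0, ∀ u, (M₀ - ε • M₁) u = 0 → u = 0 := by
  by_contra hcon
  rw [not_eventually] at hcon
  obtain ⟨ε, hε, hu⟩ := exists_seq_forall_of_frequently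
    (hcon.and_eventually eventually_mem_nhdsWithin)
  have hex : ∀ m, ∃ u : E, u ∈ Metric.sphere (0 : E) 1 ∧ ∀ w, M₀ u w = ε m * M₁ u w := by
    intro m
    obtain ⟨h1, -⟩ := hu m
    push Not at h1
    obtain ⟨u, hu, hu0⟩ := h1
    refine ⟨‖u‖⁻¹ • u, ?_, fun w => ?_⟩
    · rw [mem_sphere_zero_iff_norm, norm_smul, norm_inv, norm_norm,
        inv_mul_cancel₀ (norm_ne_zero_iff.2 hu0)]
    · have h2 : M₀ u w - ε m * M₁ u w = 0 := by simpa using LinearMap.congr_fun hu w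
      rw [map_smul, map_smul, LinearMap.smul_apply, LinearMap.smul_apply, smul_eq_mul, smul_eq_mul,
        sub_eq_zero.1 h2]
      ring
  choose u hu1 hu2 using hex
  obtain ⟨x, hx, φ, hφ, hlim⟩ := (isCompact_sphere (0 : E) 1).tendsto_subseq hu1
  have hε0 : Tendsto (fun m => ε (φ m)) atTop (𝓝 0) :=
    (hε.mono_right nhdsWithin_le_nhds).comp hφ.tendsto_atTop
  have hM : ∀ (M : E →ₗ[ℝ] E →ₗ[ℝ] ℝ) w, Tendsto (fun m => M (u (φ m)) w) atTop (𝓝 (M x w)) := by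
    intro M w
    exact ((M.flip w).continuous_of_finiteDimensional.tendsto x).comp hlim
  have hx0 : M₀ x = 0 := by
    ext w
    have h1 := hM M₀ w
    have h2 := hε0.mul (hM M₁ w)
    rw [zero_mul] at h2
    exact tendsto_nhds_unique h1 (h2.congr fun m => (hu2 (φ m) w).symm)
  have hx1 : ∀ w, M₀ w = 0 → M₁ x w = 0 := by
    intro w hw
    have h1 : ∀ m, M₁ (u (φ m)) w = 0 := by
      intro m
      have h2 := hu2 (φ m) w
      rw [h₀, hw, LinearMap.zero_apply] at h2
      exact (mul_eq_zero.1 h2.symm).resolve_left (hu (φ m)).2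
    refine tendsto_nhds_unique (hM M₁ w) ?_
    simp [h1]
  have := h x hx0 hx1
  rw [this] at hx
  simp at hx

section Config

variable {ι V : Type*} [Fintype ι] [DecidableEq ι] [AddCommGroup V] [Module ℝ V]

/-- If `b` is a relation on `t` with the smallest possible radical and `T` forms a circuit modulo
`t`, then a relation extending the circuit perturbs `b` to a relation on `t ∪ T` with the smallest
possible radical. -/
theorem IsCircuitModulo.exists_relation {A : ι → V} {ξ : Dual ℝ V} (hξ : ∀ k, ξ (A k) = 1)
    {p : ι} {t T : Finset ι} (hp : p ∈ t) (hd : Disjoint t T) {b : ι → ℝ}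
    (hb : b ∈ relations A t)
    (hrad : ∀ v : Dual ℝ V, ∑ k, (b k * v (A k)) • A k = 0 → ∃ c, ∀ k ∈ t, v (A k) = c)
    (hc : IsCircuitModulo A p (Submodule.span ℝ ((fun k => A k - A p) '' (t : Set ι))) T) :
    ∃ b' ∈ relations A (t ∪ T),
      ∀ v : Dual ℝ V, ∑ k, (b' k * v (A k)) • A k = 0 → ∃ c, ∀ k ∈ t ∪ T, v (A k) = c := by
  obtain ⟨l, hl0, hlsum, hlmem, hluniq⟩ := hc
  -- a relation that restricts to `l` on `T`
  obtain ⟨b₁, hb₁, hb₁T⟩ : ∃ b₁ ∈ relations A (t ∪ T), ∀ k ∈ T, b₁ k = l k := by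
    have h1 : ∑ k ∈ T, l k • A k ∈ Submodule.span ℝ (A '' (t : Set ι)) := by
      have h2 : ∑ k ∈ T, l k • (A k - A p) ∈ Submodule.span ℝ (A '' (t : Set ι)) := by
        rw [span_image_eq_span_sub A (s := (t : Set ι)) hp]
        exact Submodule.mem_sup_right hlmem
      rw [sum_smul_sub] at h2
      have h3 := Submodule.add_mem _ h2 (Submodule.smul_mem _ (∑ k ∈ T, l k)
        (Submodule.subset_span ⟨p, hp, rfl⟩))
      rwa [sub_add_cancel] at h3
    rw [Submodule.mem_span_image_finset_iff_exists_fun'] at h1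
    obtain ⟨c, hc⟩ := h1
    refine ⟨fun k => (if k ∈ T then l k else 0) - if k ∈ t then c k else 0, ⟨fun k hk => ?_, ?_⟩,
      fun k hk => ?_⟩
    · rw [Finset.mem_union, not_or] at hk
      simp [hk.1, hk.2]
    · simp [sub_smul, Finset.sum_sub_distrib, ite_smul, Finset.sum_ite_mem, hc]
    · have : k ∉ t := Finset.disjoint_right.1 hd hk
      simp [hk, this]
  have hb' := relations_mono A (Finset.subset_union_left (s₁ := t) (s₂ := T)) hb
  have hps : p ∈ t ∪ T := Finset.mem_union_left _ hp
  have hev := eventually_ker_sub_smul_eq_bot (valueForm A (t ∪ T) p b) (valueForm A (t ∪ T) p b₁)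
    (valueForm_symm A _ p b) (by
      intro u hu hu1
      obtain ⟨v, rfl⟩ := LinearMap.surjective_rangeRestrict _ u
      obtain ⟨c, hvc⟩ := hrad v ((valueForm_eq_zero_iff hξ hb' p v).1 hu)
      have hsumT : ∀ w : Dual ℝ V, ∑ k, b₁ k * (v - c • ξ) (A k) * w (A k) =
          ∑ k ∈ T, l k * (v (A k) - c) * w (A k) := by
        intro w
        rw [← Finset.sum_subset (Finset.subset_univ T)]
        · exact Finset.sum_congr rfl fun k hk => by simp [hb₁T k hk, hξ]
        · intro k _ hkT
          by_cases hkt : k ∈ t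
          · simp [hvc k hkt, hξ]
          · simp [hb₁.1 k (by simp [hkt, hkT])]
      have hsum0 : ∑ k ∈ T, l k * (v (A k) - c) = 0 := by
        have h1 := hsumT ξ
        simp only [hξ, mul_one] at h1
        rw [← h1]
        exact dual_sum_eq_zero hb₁ _
      -- a linear form `w` detecting that this vector is not in the span would lie in the radical of
      -- `b` but would not be orthogonal to `v` for `b₁`
      have hmem : ∑ k ∈ T, (l k * (v (A k) - c)) • (A k - A p) ∈
          Submodule.span ℝ ((fun k => A k - A p) '' (t : Set ι)) := by
        by_contra hnot
        obtain ⟨w, hw, hwle⟩ := Submodule.exists_le_ker_of_notMem hnot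
        apply hw
        have hwt : ∀ k ∈ t, w (A k) = w (A p) := by
          intro k hk
          have : w (A k - A p) = 0 := hwle (Submodule.subset_span ⟨k, hk, rfl⟩)
          rwa [map_sub, sub_eq_zero] at this
        have hw0 := hu1 ((valueMap A (t ∪ T) p).rangeRestrict w) (by
          rw [valueForm_eq_zero_iff hξ hb' p w]
          calc ∑ k, (b k * w (A k)) • A k = ∑ k, w (A p) • (b k • A k) := by
                refine Finset.sum_congr rfl fun k _ => ?_
                by_cases hk : k ∈ t
                · rw [hwt k hk, smul_smul, mul_comm]
                · simp [hb.1 k hk]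
            _ = 0 := by rw [← Finset.smul_sum, hb.2, smul_zero])
        rw [valueForm_rangeRestrict hξ hb₁ p, map_sum] at hw0
        simp only [map_smul, smul_eq_mul] at hw0
        have h1 := hsumT w
        simp only [LinearMap.sub_apply, LinearMap.smul_apply, hξ, smul_eq_mul, mul_one, mul_sub,
          sub_mul, Finset.sum_sub_distrib] at h1
        rw [hw0] at h1
        have h2 : ∑ k, b₁ k * c * w (A k) = 0 := by
          rw [← mul_zero c, ← dual_sum_eq_zero hb₁ w, Finset.mul_sum]
          exact Finset.sum_congr rfl fun k _ => by ring
        rw [h2, sub_zero] at h1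
        have h3 : ∑ k ∈ T, l k * (v (A k) - c) * w (A k) = 0 := by
          rw [h1, ← Finset.sum_sub_distrib]
          exact Finset.sum_congr rfl fun k _ => by ring
        rw [map_sum]
        simp only [map_smul, map_sub, smul_eq_mul, mul_sub (_ * _), Finset.sum_sub_distrib]
        rw [h3, ← Finset.sum_mul, hsum0, zero_mul, sub_zero]
      -- so `l k * (v (A k) - c)` is a multiple of the circuit relation; its sum vanishes, that of `l`
      -- does not
      obtain ⟨m, hm⟩ := hluniq _ hmem
      have hm0 : m = 0 := by
        have h1 : m * ∑ k ∈ T, l k = 0 := by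
          rw [← hsum0, Finset.mul_sum]
          exact Finset.sum_congr rfl fun k hk => (hm k hk).symm
        exact (mul_eq_zero.1 h1).resolve_right hlsum
      rw [rangeRestrict_valueMap_eq_zero_iff hps]
      refine ⟨c, fun k hk => ?_⟩
      rcases Finset.mem_union.1 hk with hk | hk
      · exact hvc k hk
      · have h1 := hm k hk
        rw [hm0, zero_mul] at h1
        exact sub_eq_zero.1 ((mul_eq_zero.1 h1).resolve_left (hl0 k hk)))
  obtain ⟨ε, hε⟩ := hev.exists
  have hmem : b - ε • b₁ ∈ relations A (t ∪ T) :=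
    Submodule.sub_mem _ hb' (Submodule.smul_mem _ _ hb₁)
  refine ⟨b - ε • b₁, hmem, fun v hv => ?_⟩
  rw [← valueForm_eq_zero_iff hξ hmem p, valueForm_sub_smul] at hv
  exact (rangeRestrict_valueMap_eq_zero_iff hps v).1 (hε _ hv)

/-- Every chain carries a relation with the smallest possible radical, built level by level starting
from the zero relation on the base point. -/
theorem IsChain.exists_relation {A : ι → V} {ξ : Dual ℝ V} (hξ : ∀ k, ξ (A k) = 1)
    {p : ι} {s : Finset ι} {r : ℕ} {lev : ι → ℕ} (h : IsChain A p s r lev) :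
    ∃ b ∈ relations A s,
      ∀ v : Dual ℝ V, ∑ k, (b k * v (A k)) • A k = 0 → ∃ c, ∀ k ∈ s, v (A k) = c := by
  have key : ∀ m ≤ r, ∃ b ∈ relations A (s.filter fun k => k = p ∨ lev k < m),
      ∀ v : Dual ℝ V, ∑ k, (b k * v (A k)) • A k = 0 →
        ∃ c, ∀ k ∈ s.filter fun k => k = p ∨ lev k < m, v (A k) = c := by
    intro m
    induction m with
    | zero =>
      intro _
      refine ⟨0, Submodule.zero_mem _, fun v _ => ⟨v (A p), fun k hk => ?_⟩⟩
      rw [Finset.mem_filter] at hk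
      rw [hk.2.resolve_right (Nat.not_lt_zero _)]
    | succ m ih =>
      intro hm
      obtain ⟨b, hb, hrad⟩ := ih (by omega)
      have hc := h.circuit m hm
      have hlow : lowerSpan A p s lev m = Submodule.span ℝ ((fun k => A k - A p) ''
          ((s.filter fun k => k = p ∨ lev k < m : Finset ι) : Set ι)) := by
        apply le_antisymm
        · refine Submodule.span_mono (Set.image_mono fun k hk => ?_)
          simpa using ⟨hk.1, Or.inr hk.2.2⟩
        · rw [Submodule.span_le]
          rintro _ ⟨k, hk, rfl⟩
          rw [Finset.mem_coe, Finset.mem_filter] at hk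
          by_cases hkp : k = p
          · simp [hkp]
          · exact Submodule.subset_span ⟨k, ⟨hk.1, hkp, hk.2.resolve_left hkp⟩, rfl⟩
      rw [hlow] at hc
      have hunion : (s.filter fun k => k = p ∨ lev k < m) ∪
          (s.filter fun k => k ≠ p ∧ lev k = m) = s.filter fun k => k = p ∨ lev k < m + 1 := by
        ext k
        simp only [Finset.mem_union, Finset.mem_filter]
        by_cases hkp : k = p
        · simp [hkp]
        · simp only [hkp, false_or, ne_eq, not_false_eq_true, true_and, ← and_or_left]
          rw [Nat.lt_succ_iff_lt_or_eq]
      rw [← hunion]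
      refine hc.exists_relation hξ (by simp [h.base_mem]) ?_ hb hrad
      rw [Finset.disjoint_filter]
      rintro k - hk ⟨hkp, hkm⟩
      exact absurd (hk.resolve_left hkp) (by omega)
  have hs : (s.filter fun k => k = p ∨ lev k < r) = s := by
    rw [Finset.filter_eq_self]
    intro k hk
    by_cases hkp : k = p
    · exact Or.inl hkp
    · exact Or.inr (h.lev_lt k hk hkp)
  have := key r le_rfl
  rwa [hs] at this

/-- A relation with the smallest possible radical can be moved into general position. -/
theorem exists_isNondegenerate_univ [Nontrivial ι] {A : ι → V} {ξ : Dual ℝ V}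
    (hξ : ∀ k, ξ (A k) = 1) {b : ι → ℝ} (hb : b ∈ relations A Finset.univ)
    (hrad : ∀ v : Dual ℝ V, ∑ k, (b k * v (A k)) • A k = 0 → ∃ c, ∀ k, v (A k) = c) :
    ∃ b', IsNondegenerate A Finset.univ b' := by
  -- no coordinate vanishes on all relations
  have hcoord : ∀ k, ∃ c ∈ relations A Finset.univ, c k ≠ 0 := by
    intro k
    by_contra! hk
    obtain ⟨v, hv⟩ := exists_dual_of_forall_relations A Finset.univ (Pi.single k 1) (by
      intro c hc
      rw [Finset.sum_eq_single k]
      · simp [hk c hc]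
      · intro l _ hl
        simp [hl]
      · simp)
    obtain ⟨c, hc⟩ := hrad v (Finset.sum_eq_zero fun l _ => by
      by_cases hl : l = k
      · simp [hl, hk b hb]
      · simp [hv l (Finset.mem_univ l), hl])
    obtain ⟨l, hl⟩ := exists_ne k
    have h1 := (hc k).trans (hc l).symm
    rw [hv k (Finset.mem_univ k), hv l (Finset.mem_univ l)] at h1
    simp [hl] at h1
  obtain ⟨b₁, hb₁, hb₁0⟩ : ∃ b₁ ∈ relations A Finset.univ, ∀ k, b₁ k ≠ 0 := by
    let S : ι → Subspace ℝ (relations A Finset.univ) := fun k =>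
      LinearMap.ker ((LinearMap.proj k : (ι → ℝ) →ₗ[ℝ] ℝ) ∘ₗ (relations A Finset.univ).subtype)
    have hS : ⊤ ∉ Finset.univ.image S := by
      intro h
      obtain ⟨k, -, hk⟩ := Finset.mem_image.1 h
      obtain ⟨d, hd, hdk⟩ := hcoord k
      have : (⟨d, hd⟩ : relations A Finset.univ) ∈ S k := hk ▸ Submodule.mem_top
      exact hdk this
    have := Subspace.biUnion_ne_univ_of_top_notMem hS
    rw [Set.ne_univ_iff_exists_notMem] at this
    obtain ⟨d, hd⟩ := this
    refine ⟨d.1, d.2, fun k hk => hd ?_⟩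
    rw [Set.mem_iUnion₂]
    exact ⟨S k, by simp, hk⟩
  obtain ⟨p⟩ : Nonempty ι := inferInstance
  have hp : p ∈ (Finset.univ : Finset ι) := Finset.mem_univ p
  have hev := eventually_ker_sub_smul_eq_bot (valueForm A Finset.univ p b)
    (valueForm A Finset.univ p b₁) (valueForm_symm A _ p b) (by
      intro u hu _
      obtain ⟨v, rfl⟩ := LinearMap.surjective_rangeRestrict _ u
      rw [rangeRestrict_valueMap_eq_zero_iff hp]
      obtain ⟨c, hc⟩ := hrad v ((valueForm_eq_zero_iff hξ hb p v).1 hu)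
      exact ⟨c, fun k _ => hc k⟩)
  have hev' : ∀ᶠ ε : ℝ in 𝓝[≠] 0, ∀ k, b k - ε * b₁ k ≠ 0 := by
    rw [eventually_all]
    intro k
    by_cases hk : b k = 0
    · filter_upwards [eventually_mem_nhdsWithin] with ε hε
      rw [hk, zero_sub, neg_ne_zero]
      exact mul_ne_zero hε (hb₁0 k)
    · have hcont : ContinuousAt (fun ε : ℝ => b k - ε * b₁ k) 0 := by fun_prop
      exact (hcont.eventually_ne (by simpa using hk)).filter_mono nhdsWithin_le_nhds
  obtain ⟨ε, hε, hε'⟩ := (hev.and hev').exists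
  have hmem : b - ε • b₁ ∈ relations A Finset.univ :=
    Submodule.sub_mem _ hb (Submodule.smul_mem _ _ hb₁)
  refine ⟨b - ε • b₁, hmem, fun k _ => hε' k, fun v hv => ?_⟩
  rw [← valueForm_eq_zero_iff hξ hmem p, valueForm_sub_smul] at hv
  exact (rangeRestrict_valueMap_eq_zero_iff hp v).1 (hε _ hv)

end Config

/-! ### Nondegenerate complex relations -/

section Complex

variable {ι : Type*} {n : ℕ}

/-- The complex version of a nondegenerate relation with full support. -/
structure IsNondegenerateComplex [Fintype ι] (A : ι → Fin (n + 1) → ℝ) (b : ι → ℂ) : Prop where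
  ne_zero : ∀ k, b k ≠ 0
  rel : ∀ i, ∑ k, b k * (A k i : ℂ) = 0
  const : ∀ w : Fin (n + 1) → ℂ,
    (∀ i, ∑ k, b k * (∑ j, w j * (A k j : ℂ)) * (A k i : ℂ) = 0) →
      ∃ c : ℂ, ∀ k, ∑ j, w j * (A k j : ℂ) = c

theorem eq_zero_of_forall_sum_eq_zero {A : ι → Fin (n + 1) → ℝ}
    (hspan : Submodule.span ℝ (Set.range A) = ⊤) {w : Fin (n + 1) → ℂ}
    (hw : ∀ k, ∑ j, w j * (A k j : ℂ) = 0) : w = 0 := by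
  have hreal : ∀ x : Fin (n + 1) → ℝ, (∀ k, ∑ j, x j * A k j = 0) → x = 0 := by
    intro x hx
    have hle : Submodule.span ℝ (Set.range A) ≤
        LinearMap.ker (∑ j, x j • (LinearMap.proj j : (Fin (n + 1) → ℝ) →ₗ[ℝ] ℝ)) := by
      rw [Submodule.span_le]
      rintro _ ⟨k, rfl⟩
      simpa using hx k
    rw [hspan] at hle
    ext j
    have := hle (Submodule.mem_top (x := Pi.single j 1))
    simpa [Pi.single_apply] using this
  have hre := hreal (fun j => (w j).re) fun k => by
    simpa [Complex.re_sum] using congrArg Complex.re (hw k)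
  have him := hreal (fun j => (w j).im) fun k => by
    simpa [Complex.im_sum] using congrArg Complex.im (hw k)
  ext j
  exact Complex.ext (congrFun hre j) (congrFun him j)

theorem IsNondegenerate.complex [Fintype ι] {A : ι → Fin (n + 1) → ℝ} {b : ι → ℝ}
    (hb : IsNondegenerate A Finset.univ b) :
    IsNondegenerateComplex A fun k => (b k : ℂ) := by
  have hconst : ∀ x : Fin (n + 1) → ℝ,
      (∀ i, ∑ k, b k * (∑ j, x j * A k j) * A k i = 0) → ∃ c, ∀ k, ∑ j, x j * A k j = c := by
    intro x hx
    obtain ⟨c, hc⟩ := hb.const (∑ j, x j • LinearMap.proj j) (by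
      ext i
      simpa using hx i)
    exact ⟨c, fun k => by simpa using hc k (Finset.mem_univ k)⟩
  refine ⟨fun k => by simpa using hb.ne_zero k (Finset.mem_univ k), fun i => ?_, fun w hw => ?_⟩
  · have := congrFun hb.mem.2 i
    simp only [Finset.sum_apply, Pi.smul_apply, smul_eq_mul, Pi.zero_apply] at this
    exact_mod_cast this
  · obtain ⟨c, hc⟩ := hconst (fun j => (w j).re) fun i => by
      simpa [Complex.re_sum, Complex.im_sum] using congrArg Complex.re (hw i)
    obtain ⟨d, hd⟩ := hconst (fun j => (w j).im) fun i => by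
      simpa [Complex.re_sum, Complex.im_sum] using congrArg Complex.im (hw i)
    refine ⟨⟨c, d⟩, fun k => Complex.ext ?_ ?_⟩
    · simpa [Complex.re_sum] using hc k
    · simpa [Complex.im_sum] using hd k

open Polynomial in
/-- Nondegeneracy of a relation `x + z y` with full support is the nonvanishing of a real
polynomial in `z`, so that it holds for some real `z` as soon as it holds for `z = i`. The
polynomial involves the determinant of `∑ bₖ αₖ αₖᵀ + ξ ξᵀ`, where the second summand makes up
for the one-dimensional kernel common to all relations. -/
theorem IsNondegenerateComplex.exists_real [Fintype ι] {A : ι → Fin (n + 1) → ℝ} (hA : IsSpectrum A)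
    {b : ι → ℂ} (hb : IsNondegenerateComplex A b) :
    ∃ b', IsNondegenerate A Finset.univ b' := by
  obtain ⟨⟨ξ, hξ⟩, hspan⟩ := hA
  simp only [dotProduct] at hξ
  have hξC : ∀ k, ∑ j, (ξ j : ℂ) * (A k j : ℂ) = 1 := fun k => by exact_mod_cast hξ k
  have hξ0 : ∑ j, ξ j * ξ j ≠ 0 := by
    intro h0
    rw [Finset.sum_eq_zero_iff_of_nonneg fun j _ => mul_self_nonneg _] at h0
    have hz : ∀ j, ξ j = 0 := fun j => mul_self_eq_zero.1 (h0 j (Finset.mem_univ j))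
    cases isEmpty_or_nonempty ι with
    | inl _ =>
      rw [Set.range_eq_empty, Submodule.span_empty] at hspan
      exact bot_ne_top hspan
    | inr hne =>
      obtain ⟨k⟩ := hne
      simpa [hz] using hξ k
  -- `Q` vanishes at a real `z` exactly if the relation `Re b + z Im b` has a zero entry or a radical
  -- larger than the span of `ξ`
  let N : Matrix (Fin (n + 1)) (Fin (n + 1)) ℝ[X] := Matrix.of fun i j =>
    ∑ k, (C (b k).re + X * C (b k).im) * C (A k i * A k j) + C (ξ i * ξ j)
  let Q : ℝ[X] := N.det * ∏ k, (C (b k).re + X * C (b k).im)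
  have hbI : ∀ k, aeval Complex.I (C (b k).re + X * C (b k).im) = b k := by
    intro k
    simp only [map_add, map_mul, aeval_C, aeval_X, Complex.coe_algebraMap]
    rw [mul_comm, Complex.re_add_im]
  have hNI : (aeval (R := ℝ) Complex.I).toRingHom.mapMatrix N = Matrix.of fun i j =>
      ∑ k, b k * ((A k i : ℂ) * (A k j : ℂ)) + (ξ i : ℂ) * (ξ j : ℂ) := by
    ext i j
    simp only [N, RingHom.mapMatrix_apply, Matrix.map_apply, Matrix.of_apply,
      AlgHom.toRingHom_eq_coe, RingHom.coe_coe]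
    rw [map_add, map_sum, aeval_C, Complex.coe_algebraMap, Complex.ofReal_mul]
    congr 1
    refine Finset.sum_congr rfl fun k _ => ?_
    rw [map_mul, hbI, aeval_C, Complex.coe_algebraMap, Complex.ofReal_mul]
  have hdetI : aeval Complex.I N.det ≠ 0 := by
    change (aeval (R := ℝ) Complex.I).toRingHom N.det ≠ 0
    rw [RingHom.map_det, hNI]
    intro hdet
    obtain ⟨w, hw0, hw⟩ := Matrix.exists_mulVec_eq_zero_iff.2 hdet
    have hwi : ∀ i, ∑ k, b k * (∑ j, w j * (A k j : ℂ)) * (A k i : ℂ) +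
        ξ i * ∑ j, w j * (ξ j : ℂ) = 0 := by
      intro i
      refine Eq.trans ?_ (congrFun hw i)
      simp only [Matrix.mulVec, dotProduct, Matrix.of_apply, add_mul, Finset.sum_add_distrib,
        Finset.sum_mul, Finset.mul_sum]
      rw [Finset.sum_comm]
      congr 1
      · exact Finset.sum_congr rfl fun j _ => Finset.sum_congr rfl fun k _ => by ring
      · exact Finset.sum_congr rfl fun j _ => by ring
    have hξw : ∑ j, w j * (ξ j : ℂ) = 0 := by
      have h1 : ∑ i, (ξ i : ℂ) * (∑ k, b k * (∑ j, w j * (A k j : ℂ)) * (A k i : ℂ) +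
          ξ i * ∑ j, w j * (ξ j : ℂ)) = 0 := Finset.sum_eq_zero fun i _ => by rw [hwi, mul_zero]
      simp only [mul_add, Finset.sum_add_distrib] at h1
      have h2 : ∑ i, (ξ i : ℂ) * ∑ k, b k * (∑ j, w j * (A k j : ℂ)) * (A k i : ℂ) = 0 := by
        calc ∑ i, (ξ i : ℂ) * ∑ k, b k * (∑ j, w j * (A k j : ℂ)) * (A k i : ℂ)
            = ∑ k, b k * (∑ j, w j * (A k j : ℂ)) * ∑ i, (ξ i : ℂ) * (A k i : ℂ) := by
              simp_rw [Finset.mul_sum (s := (Finset.univ : Finset ι)),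
                Finset.mul_sum _ (fun i => (ξ i : ℂ) * _)]
              rw [Finset.sum_comm]
              exact Finset.sum_congr rfl fun k _ => Finset.sum_congr rfl fun i _ => by ring
          _ = ∑ j, w j * ∑ k, b k * (A k j : ℂ) := by
              simp only [hξC, mul_one, Finset.mul_sum]
              rw [Finset.sum_comm]
              exact Finset.sum_congr rfl fun j _ => Finset.sum_congr rfl fun k _ => by ring
          _ = 0 := Finset.sum_eq_zero fun j _ => by rw [hb.rel, mul_zero]
      rw [h2, zero_add] at h1
      simp only [← mul_assoc, ← Finset.sum_mul] at h1
      exact (mul_eq_zero.1 h1).resolve_left (by exact_mod_cast hξ0)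
    obtain ⟨c, hc⟩ := hb.const w fun i => by simpa [hξw] using hwi i
    have hwc : w = fun j => c * ξ j := by
      rw [← sub_eq_zero]
      refine eq_zero_of_forall_sum_eq_zero hspan fun k => ?_
      simp only [Pi.sub_apply, sub_mul, Finset.sum_sub_distrib, hc, mul_assoc, ← Finset.mul_sum,
        hξC]
      ring
    have hc0 : c = 0 := by
      rw [hwc] at hξw
      simp only [mul_assoc, ← Finset.mul_sum] at hξw
      exact (mul_eq_zero.1 hξw).resolve_right (by exact_mod_cast hξ0)
    exact hw0 (by rw [hwc, hc0]; ext; simp)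
  have hQ : Q ≠ 0 := by
    intro h0
    have h1 : aeval Complex.I Q = 0 := by rw [h0, map_zero]
    rw [map_mul, map_prod] at h1
    refine (mul_ne_zero hdetI (Finset.prod_ne_zero_iff.2 fun k _ => ?_)) h1
    rw [hbI]
    exact hb.ne_zero k
  obtain ⟨z, hz⟩ : ∃ z : ℝ, Q.eval z ≠ 0 := by
    by_contra! hcon
    exact hQ (Polynomial.funext fun r => by simpa using hcon r)
  rw [eval_mul, eval_prod] at hz
  obtain ⟨hdet, hprod⟩ := mul_ne_zero_iff.1 hz
  set b' : ι → ℝ := fun k => (b k).re + z * (b k).im with hb'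
  have hNz : (evalRingHom z).mapMatrix N = Matrix.of fun i j =>
      ∑ k, b' k * (A k i * A k j) + ξ i * ξ j := by
    ext i j
    simp [N, hb', eval_finsetSum, mul_comm z]
  have hrel : ∀ i, ∑ k, b' k * A k i = 0 := by
    intro i
    have h1 : ∑ k, (b k).re * A k i = 0 := by
      simpa [Complex.re_sum] using congrArg Complex.re (hb.rel i)
    have h2 : ∑ k, (b k).im * A k i = 0 := by
      simpa [Complex.im_sum] using congrArg Complex.im (hb.rel i)
    simp only [hb', add_mul, Finset.sum_add_distrib, mul_assoc, ← Finset.mul_sum, h1, h2]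
    ring
  refine ⟨b', ⟨by simp, ?_⟩, fun k _ => ?_, fun v hv => ?_⟩
  · ext i
    simpa using hrel i
  · have := Finset.prod_ne_zero_iff.1 hprod k (Finset.mem_univ k)
    simpa [hb', mul_comm z] using this
  · have hvA : ∀ x : Fin (n + 1) → ℝ, v x = ∑ j, v (Pi.single j 1) * x j := by
      intro x
      conv_lhs => rw [pi_eq_sum_univ' x]
      rw [map_sum]
      refine Finset.sum_congr rfl fun j _ => ?_
      rw [map_smul, smul_eq_mul, mul_comm]
    set t := v ξ / ∑ j, ξ j * ξ j with ht
    have hker : (fun j => v (Pi.single j 1) - t * ξ j) = 0 := by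
      by_contra hne
      have hdet0 := Matrix.exists_mulVec_eq_zero_iff.1 ⟨_, hne, (?_ :
        (evalRingHom z).mapMatrix N *ᵥ (fun j => v (Pi.single j 1) - t * ξ j) = 0)⟩
      · rw [← RingHom.map_det, coe_evalRingHom] at hdet0
        exact hdet hdet0
      · rw [hNz]
        ext i
        have h1 : ∑ k, b' k * v (A k) * A k i = 0 := by simpa using congrFun hv i
        have h2 : ∑ j, ξ j * (v (Pi.single j 1) - t * ξ j) = 0 := by
          have : ∑ j, ξ j * (v (Pi.single j 1) - t * ξ j) = v ξ - t * ∑ j, ξ j * ξ j := by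
            rw [hvA ξ, Finset.mul_sum, ← Finset.sum_sub_distrib]
            exact Finset.sum_congr rfl fun j _ => by ring
          rw [this, ht, div_mul_cancel₀ _ hξ0, sub_self]
        have h3 : ∀ k, ∑ j, A k j * (v (Pi.single j 1) - t * ξ j) = v (A k) - t := by
          intro k
          have : ∑ j, A k j * (v (Pi.single j 1) - t * ξ j) =
              ∑ j, v (Pi.single j 1) * A k j - t * ∑ j, ξ j * A k j := by
            rw [Finset.mul_sum, ← Finset.sum_sub_distrib]
            exact Finset.sum_congr rfl fun j _ => by ring
          rw [this, hξ, mul_one, ← hvA]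
        calc ∑ j, (∑ k, b' k * (A k i * A k j) + ξ i * ξ j) * (v (Pi.single j 1) - t * ξ j)
            = ∑ k, b' k * A k i * ∑ j, A k j * (v (Pi.single j 1) - t * ξ j) +
                ξ i * ∑ j, ξ j * (v (Pi.single j 1) - t * ξ j) := by
              simp only [add_mul, Finset.sum_add_distrib, Finset.sum_mul, Finset.mul_sum]
              rw [Finset.sum_comm]
              congr 1
              · exact Finset.sum_congr rfl fun j _ => Finset.sum_congr rfl fun k _ => by ring
              · exact Finset.sum_congr rfl fun j _ => by ring
          _ = ∑ k, (b' k * v (A k) * A k i - t * (b' k * A k i)) := by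
              rw [h2, mul_zero, add_zero]
              exact Finset.sum_congr rfl fun k _ => by rw [h3]; ring
          _ = 0 := by
              rw [Finset.sum_sub_distrib, h1, ← Finset.mul_sum, hrel, mul_zero, sub_zero]
    refine ⟨t, fun k _ => ?_⟩
    have h4 : ∑ j, v (Pi.single j 1) * A k j = t * ∑ j, ξ j * A k j := by
      rw [Finset.mul_sum]
      refine Finset.sum_congr rfl fun j _ => ?_
      rw [sub_eq_zero.1 (congrFun hker j), mul_assoc]
    rw [hvA, h4, hξ, mul_one]

/-! ### The dual variety -/

theorem hasFDerivAt_expSum [Fintype ι] (A : ι → Fin (n + 1) → ℝ) (c : ι → ℂ) (w : Fin (n + 1) → ℂ) :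
    HasFDerivAt (expSum A c) (∑ k, c k • Complex.exp (∑ i, w i * (A k i : ℂ)) •
      ∑ i, (A k i : ℂ) • (ContinuousLinearMap.proj i : (Fin (n + 1) → ℂ) →L[ℂ] ℂ)) w := by
  refine HasFDerivAt.fun_sum fun k _ => HasFDerivAt.const_mul (HasFDerivAt.cexp ?_) _
  refine HasFDerivAt.fun_sum fun i _ => ?_
  exact (hasFDerivAt_apply i w).mul_const _

/-- Singular points are relations after rescaling; the vanishing of the function itself follows
from that of its differential, by homogeneity. -/
theorem mem_dualVariety_iff [Fintype ι] {A : ι → Fin (n + 1) → ℝ} {ξ : Fin (n + 1) → ℝ}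
    (hξ : ∀ k, ξ ⬝ᵥ A k = 1) {c : ι → ℂ} :
    c ∈ dualVariety A ↔ (∀ k, c k ≠ 0) ∧ ∃ w : Fin (n + 1) → ℂ,
      ∀ i, ∑ k, c k * Complex.exp (∑ i, w i * (A k i : ℂ)) * (A k i : ℂ) = 0 := by
  have hξC : ∀ k, ∑ j, (ξ j : ℂ) * (A k j : ℂ) = 1 := fun k => by exact_mod_cast hξ k
  refine and_congr_right fun _ => exists_congr fun w => ?_
  rw [(hasFDerivAt_expSum A c w).fderiv]
  constructor
  · rintro ⟨-, h⟩ i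
    have := congrArg (fun f => f (Pi.single i 1)) h
    simpa [Pi.single_apply, mul_assoc] using this
  · intro h
    constructor
    · calc expSum A c w = ∑ k, c k * Complex.exp (∑ i, w i * (A k i : ℂ)) *
            ∑ j, (ξ j : ℂ) * (A k j : ℂ) := by simp only [hξC, mul_one]; rfl
        _ = ∑ j, (ξ j : ℂ) * ∑ k, c k * Complex.exp (∑ i, w i * (A k i : ℂ)) * (A k j : ℂ) := by
          simp only [Finset.mul_sum]
          rw [Finset.sum_comm]
          exact Finset.sum_congr rfl fun j _ => Finset.sum_congr rfl fun k _ => by ring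
        _ = 0 := Finset.sum_eq_zero fun j _ => by rw [h, mul_zero]
    · ext u
      calc _ = ∑ i, u i * ∑ k, c k * Complex.exp (∑ i, w i * (A k i : ℂ)) * (A k i : ℂ) := by
            simp only [Finset.mul_sum, sum_apply, smul_apply, smul_eq_mul,
              ContinuousLinearMap.proj_apply]
            rw [Finset.sum_comm]
            exact Finset.sum_congr rfl fun j _ => Finset.sum_congr rfl fun k _ => by ring
        _ = 0 := Finset.sum_eq_zero fun j _ => by rw [h, mul_zero]

end Complex

/-! ### Complex submanifolds and linear projections -/

/-- A complex differentiable map is strictly differentiable: by the Schwarz lemma, applied to the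
difference with the linear approximation on small balls, its derivative is continuous. -/
theorem hasStrictFDerivAt_of_differentiableOn {E F : Type*} [NormedAddCommGroup E]
    [NormedSpace ℂ E] [NormedAddCommGroup F] [NormedSpace ℂ F] {U : Set E} (hU : IsOpen U)
    {f : E → F} (hf : DifferentiableOn ℂ f U) {x : E} (hx : x ∈ U) :
    HasStrictFDerivAt f (fderiv ℂ f x) x := by
  have hfx : ∀ y ∈ U, HasFDerivAt f (fderiv ℂ f y) y := fun y hy =>
    (hf.differentiableAt (hU.mem_nhds hy)).hasFDerivAt
  refine hasStrictFDerivAt_of_hasFDerivAt_of_continuousAt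
    (by filter_upwards [hU.mem_nhds hx] with y hy using hfx y hy) ?_
  rw [Metric.continuousAt_iff]
  intro ε hε
  set L := fderiv ℂ f x
  have hlit := (hfx x hx).isLittleO.def (c := ε / 8) (by positivity)
  obtain ⟨δ, hδ, hball⟩ := Metric.mem_nhds_iff.1 (inter_mem hlit (hU.mem_nhds hx))
  refine ⟨δ / 2, by positivity, fun {y} hy => ?_⟩
  have hsub : Metric.ball y (δ / 2) ⊆ Metric.ball x δ := fun z hz => by
    rw [Metric.mem_ball] at hz ⊢
    linarith [dist_triangle z y x]
  have hg : ∀ z ∈ Metric.ball y (δ / 2), HasFDerivAt (fun z => f z - L z) (fderiv ℂ f z - L) z :=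
    fun z hz => (hfx z (hball (hsub hz)).2).sub L.hasFDerivAt
  have hest : ∀ z ∈ Metric.ball x δ, ‖f z - f x - L (z - x)‖ ≤ ε / 8 * δ := by
    intro z hz
    refine (hball hz).1.trans (mul_le_mul_of_nonneg_left ?_ (by positivity))
    rw [← dist_eq_norm]
    exact (Metric.mem_ball.1 hz).le
  have hyb : y ∈ Metric.ball y (δ / 2) := Metric.mem_ball_self (by positivity)
  have hmaps : Set.MapsTo (fun z => f z - L z) (Metric.ball y (δ / 2))
      (Metric.closedBall (f y - L y) (ε / 8 * δ + ε / 8 * δ)) := by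
    intro z hz
    rw [Metric.mem_closedBall, dist_eq_norm]
    have : f z - L z - (f y - L y) = (f z - f x - L (z - x)) - (f y - f x - L (y - x)) := by
      rw [map_sub, map_sub]; abel
    rw [this]
    exact (norm_sub_le _ _).trans (add_le_add (hest z (hsub hz)) (hest y (hsub hyb)))
  have hbound := Complex.norm_fderiv_le_div_of_mapsTo_ball
    (fun z hz => (hg z hz).differentiableAt.differentiableWithinAt) hmaps (by positivity)
  rw [(hg y hyb).fderiv] at hbound
  rw [dist_eq_norm]
  refine hbound.trans_lt ?_
  rw [div_lt_iff₀ (by positivity)]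
  nlinarith

theorem exists_injective_of_le_finrank {K M : Type*} [Field K] [AddCommGroup M] [Module K M]
    [FiniteDimensional K M] {d : ℕ} (h : d ≤ finrank K M) :
    ∃ f : (Fin d → K) →ₗ[K] M, Function.Injective f := by
  refine ⟨Fintype.linearCombination K fun i => finBasis K M (Fin.castLE h i), ?_⟩
  rw [← linearIndependent_iff_injective_fintypeLinearCombination]
  exact (finBasis K M).linearIndependent.comp _ (Fin.castLE_injective h)

/-- A set containing a submanifold of dimension at least `m` has a linear projection to `ℂ^m` whose
image has interior points. -/
theorem ContainsManifoldOfDim.exists_projection {ι : Type*} [Fintype ι] {S : Set (ι → ℂ)}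
    {d m : ℕ} (hS : ContainsManifoldOfDim S d) (hm : m ≤ d) :
    ∃ P : (ι → ℂ) →ₗ[ℂ] (Fin m → ℂ), (interior (P '' S)).Nonempty := by
  obtain ⟨U, g, hU, ⟨u, hu⟩, hg, hinj, hmaps⟩ := hS
  obtain ⟨j, hj⟩ := exists_injective_of_le_finrank (K := ℂ) (M := Fin d → ℂ) (d := m)
    (by rw [finrank_fin_fun]; exact hm)
  have hcomp : Function.Injective ((fderiv ℂ g u).toLinearMap ∘ₗ j) := (hinj u hu).comp hj
  obtain ⟨P, hP⟩ := LinearMap.exists_leftInverse_of_injective _ (LinearMap.ker_eq_bot.2 hcomp)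
  refine ⟨P, ?_⟩
  have hstrict := hasStrictFDerivAt_of_differentiableOn hU hg hu
  set J : (Fin m → ℂ) →L[ℂ] (Fin d → ℂ) := LinearMap.toContinuousLinearMap j
  set Q : (ι → ℂ) →L[ℂ] (Fin m → ℂ) := LinearMap.toContinuousLinearMap P
  have hJ : HasStrictFDerivAt (fun x => u + J x) J 0 := J.hasStrictFDerivAt.const_add u
  have hu0 : u + J 0 = u := by simp
  have hG : HasStrictFDerivAt (fun x => Q (g (u + J x)))
      (Q.comp ((fderiv ℂ g u).comp J)) 0 :=
    Q.hasStrictFDerivAt.comp 0 (HasStrictFDerivAt.comp 0 (by rwa [hu0]) hJ)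
  have hid : Q.comp ((fderiv ℂ g u).comp J) =
      ((ContinuousLinearEquiv.refl ℂ (Fin m → ℂ) : _ ≃L[ℂ] _) : (Fin m → ℂ) →L[ℂ] _) := by
    ext1 x
    exact LinearMap.congr_fun hP x
  rw [hid] at hG
  have hmap := hG.map_nhds_eq_of_equiv
  have hpre : (fun x => u + J x) ⁻¹' U ∈ 𝓝 (0 : Fin m → ℂ) := by
    refine ContinuousAt.preimage_mem_nhds (by fun_prop) ?_
    rw [hu0]
    exact hU.mem_nhds hu
  have him := image_mem_map (m := fun x => Q (g (u + J x))) hpre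
  rw [hmap] at him
  refine ⟨_, mem_interior_iff_mem_nhds.2 (mem_of_superset him ?_)⟩
  rintro _ ⟨x, hx, rfl⟩
  exact ⟨_, hmaps hx, rfl⟩

/-! ### The Horn–Kapranov parametrization -/

section Param

variable {ι : Type*} [Fintype ι] {n : ℕ}

/-- The complex linear relations of a configuration. -/
def complexRelations (A : ι → Fin (n + 1) → ℝ) : Submodule ℂ (ι → ℂ) :=
  LinearMap.ker (Fintype.linearCombination ℂ fun k i => (A k i : ℂ))

theorem mem_complexRelations {A : ι → Fin (n + 1) → ℝ} {b : ι → ℂ} :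
    b ∈ complexRelations A ↔ ∀ i, ∑ k, b k * (A k i : ℂ) = 0 := by
  rw [complexRelations, LinearMap.mem_ker, Fintype.linearCombination_apply, funext_iff]
  simp

theorem finrank_complexRelations {A : ι → Fin (n + 1) → ℝ}
    (hspan : Submodule.span ℝ (Set.range A) = ⊤) :
    finrank ℂ (complexRelations A) + (n + 1) = Fintype.card ι := by
  have h := LinearMap.finrank_range_add_finrank_ker
    (Fintype.linearCombination ℂ fun k i => (A k i : ℂ))
  have htop : LinearMap.range (Fintype.linearCombination ℂ fun k i => (A k i : ℂ)) = ⊤ := by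
    by_contra hne
    obtain ⟨f, hf0, hf⟩ := Submodule.exists_le_ker_of_lt_top _ (lt_top_iff_ne_top.2 hne)
    apply hf0
    have hf1 : (fun i => f (Pi.single i 1)) = 0 := by
      refine eq_zero_of_forall_sum_eq_zero hspan fun k => ?_
      have h1 : f (fun i => (A k i : ℂ)) = 0 := by
        apply hf
        rw [Fintype.range_linearCombination]
        exact Submodule.subset_span ⟨k, rfl⟩
      rw [pi_eq_sum_univ' (fun i => (A k i : ℂ)), map_sum] at h1
      rw [← h1]
      refine Finset.sum_congr rfl fun j _ => ?_
      rw [map_smul, smul_eq_mul, mul_comm]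
    refine LinearMap.pi_ext' fun i => LinearMap.ext_ring ?_
    exact congrFun hf1 i
  rw [htop, finrank_top, finrank_fintype_fun_eq_card, finrank_fintype_fun_eq_card,
    Fintype.card_fin] at h
  rw [complexRelations]
  omega

/-- The parametrization `(b, w) ↦ bₖ exp ⟨w, αₖ⟩` of the dual variety by relations and points of
`ℂ^{1+n}`. -/
def hornKapranov (A : ι → Fin (n + 1) → ℝ) (x : (ι → ℂ) × (Fin (n + 1) → ℂ)) : ι → ℂ :=
  fun k => x.1 k * Complex.exp (∑ i, x.2 i * (A k i : ℂ))

theorem hornKapranov_mem_dualVariety {A : ι → Fin (n + 1) → ℝ} {ξ : Fin (n + 1) → ℝ}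
    (hξ : ∀ k, ξ ⬝ᵥ A k = 1) {b : ι → ℂ} (hb : b ∈ complexRelations A) (hb0 : ∀ k, b k ≠ 0)
    (w : Fin (n + 1) → ℂ) : hornKapranov A (b, w) ∈ dualVariety A := by
  rw [mem_dualVariety_iff hξ]
  refine ⟨fun k => mul_ne_zero (hb0 k) (Complex.exp_ne_zero _), -w, fun i => ?_⟩
  rw [← mem_complexRelations.1 hb i]
  refine Finset.sum_congr rfl fun k _ => ?_
  simp [hornKapranov, mul_assoc, ← Complex.exp_add]

/-- Every point of the dual variety comes from a relation normalized to have a prescribed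
coordinate equal to `1`. -/
theorem exists_hornKapranov_eq {A : ι → Fin (n + 1) → ℝ} {ξ : Fin (n + 1) → ℝ}
    (hξ : ∀ k, ξ ⬝ᵥ A k = 1) {c : ι → ℂ} (hc : c ∈ dualVariety A) (k₀ : ι) :
    ∃ b ∈ complexRelations A, (∀ k, b k ≠ 0) ∧ b k₀ = 1 ∧ ∃ w, hornKapranov A (b, w) = c := by
  have hξC : ∀ k, ∑ j, (ξ j : ℂ) * (A k j : ℂ) = 1 := fun k => by exact_mod_cast hξ k
  obtain ⟨hc0, w, hw⟩ := (mem_dualVariety_iff hξ).1 hc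
  set b : ι → ℂ := fun k => c k * Complex.exp (∑ i, w i * (A k i : ℂ)) with hb
  have hb0 : ∀ k, b k ≠ 0 := fun k => mul_ne_zero (hc0 k) (Complex.exp_ne_zero _)
  refine ⟨(b k₀)⁻¹ • b, Submodule.smul_mem _ _ (mem_complexRelations.2 hw),
    fun k => mul_ne_zero (inv_ne_zero (hb0 k₀)) (hb0 k), inv_mul_cancel₀ (hb0 k₀),
    fun i => Complex.log (b k₀) * ξ i - w i, ?_⟩
  ext k
  have h1 : ∑ i, (Complex.log (b k₀) * ξ i - w i) * (A k i : ℂ) =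
      Complex.log (b k₀) - ∑ i, w i * (A k i : ℂ) := by
    simp only [sub_mul, Finset.sum_sub_distrib, mul_assoc, ← Finset.mul_sum, hξC, mul_one]
  simp only [hornKapranov, h1, Complex.exp_sub, Complex.exp_log (hb0 k₀), Pi.smul_apply,
    smul_eq_mul]
  have hbk : b k = c k * Complex.exp (∑ i, w i * (A k i : ℂ)) := rfl
  have h2 := hb0 k₀
  have h3 := Complex.exp_ne_zero (∑ i, w i * (A k i : ℂ))
  rw [hbk]
  clear_value b
  field_simp

theorem contDiff_hornKapranov (A : ι → Fin (n + 1) → ℝ) : ContDiff ℂ 1 (hornKapranov A) := by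
  unfold hornKapranov
  fun_prop

/-- Up to the factor `exp ⟨w, αₖ⟩`, the derivative of the parametrization at `(b, w)`. -/
def logDeriv (A : ι → Fin (n + 1) → ℝ) (b : ι → ℂ) :
    ((ι → ℂ) × (Fin (n + 1) → ℂ)) →ₗ[ℂ] (ι → ℂ) where
  toFun y := fun k => y.1 k + b k * ∑ i, y.2 i * (A k i : ℂ)
  map_add' y z := by
    ext k
    simp only [Prod.fst_add, Prod.snd_add, Pi.add_apply, add_mul, Finset.sum_add_distrib]
    ring
  map_smul' r y := by
    ext k
    simp only [Prod.smul_fst, Prod.smul_snd, Pi.smul_apply, smul_eq_mul, mul_assoc,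
      ← Finset.mul_sum, RingHom.id_apply]
    ring

theorem fderiv_hornKapranov_apply (A : ι → Fin (n + 1) → ℝ)
    (x y : (ι → ℂ) × (Fin (n + 1) → ℂ)) (k : ι) :
    fderiv ℂ (hornKapranov A) x y k =
      Complex.exp (∑ i, x.2 i * (A k i : ℂ)) * logDeriv A x.1 y k := by
  have h : HasFDerivAt (hornKapranov A) (ContinuousLinearMap.pi fun k =>
      x.1 k • Complex.exp (∑ i, x.2 i * (A k i : ℂ)) • ∑ i, (A k i : ℂ) •
        ((ContinuousLinearMap.proj i : (Fin (n + 1) → ℂ) →L[ℂ] ℂ).comp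
          (ContinuousLinearMap.snd ℂ (ι → ℂ) (Fin (n + 1) → ℂ))) +
      Complex.exp (∑ i, x.2 i * (A k i : ℂ)) •
        ((ContinuousLinearMap.proj k : (ι → ℂ) →L[ℂ] ℂ).comp
          (ContinuousLinearMap.fst ℂ (ι → ℂ) (Fin (n + 1) → ℂ)))) x := by
    rw [hasFDerivAt_pi]
    intro k
    refine HasFDerivAt.mul ?_ (HasFDerivAt.cexp ?_)
    · exact ((ContinuousLinearMap.proj k : (ι → ℂ) →L[ℂ] ℂ).comp
        (ContinuousLinearMap.fst ℂ (ι → ℂ) (Fin (n + 1) → ℂ))).hasFDerivAt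
    · refine HasFDerivAt.fun_sum fun i _ => HasFDerivAt.mul_const ?_ _
      exact ((ContinuousLinearMap.proj i : (Fin (n + 1) → ℂ) →L[ℂ] ℂ).comp
        (ContinuousLinearMap.snd ℂ (ι → ℂ) (Fin (n + 1) → ℂ))).hasFDerivAt
  rw [h.fderiv]
  simp only [logDeriv, ContinuousLinearMap.coe_pi', add_apply, smul_apply, sum_apply,
    ContinuousLinearMap.comp_apply, ContinuousLinearMap.coe_fst', ContinuousLinearMap.coe_snd',
    ContinuousLinearMap.proj_apply, smul_eq_mul, LinearMap.coe_mk, AddHom.coe_mk,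
    mul_comm (y.2 _)]
  ring

/-- At a nondegenerate relation the kernel of the derivative consists of the scalings of the
relation, so a complementary slice of the parametrization is an immersion. -/
theorem IsNondegenerateComplex.containsManifoldOfDim {A : ι → Fin (n + 1) → ℝ}
    (hA : IsSpectrum A) {b : ι → ℂ} (hb : IsNondegenerateComplex A b) :
    ContainsManifoldOfDim (dualVariety A) (Fintype.card ι - 1) := by
  obtain ⟨⟨ξ, hξ⟩, hspan⟩ := hA
  have hξC : ∀ k, ∑ j, (ξ j : ℂ) * (A k j : ℂ) = 1 := fun k => by exact_mod_cast hξ k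
  have hbmem : b ∈ complexRelations A := mem_complexRelations.2 hb.rel
  set L := complexRelations A with hL
  let I : (L × (Fin (n + 1) → ℂ)) →ₗ[ℂ] ((ι → ℂ) × (Fin (n + 1) → ℂ)) :=
    L.subtype.prodMap LinearMap.id
  let D : (L × (Fin (n + 1) → ℂ)) →ₗ[ℂ] (ι → ℂ) := logDeriv A b ∘ₗ I
  -- the parametrization is constant along `t ↦ (exp (-t) b, w + t ξ)`; nothing else is in the kernel
  have hker : LinearMap.ker D ≤
      Submodule.span ℂ {((-⟨b, hbmem⟩ : L), fun j => (ξ j : ℂ))} := by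
    rintro ⟨⟨β, hβ⟩, w⟩ h
    have hβk : ∀ k, β k = -(b k * ∑ i, w i * (A k i : ℂ)) := fun k =>
      eq_neg_of_add_eq_zero_left (congrFun (LinearMap.mem_ker.1 h) k)
    obtain ⟨c, hc⟩ := hb.const w fun i => by
      rw [← neg_eq_zero, ← mem_complexRelations.1 hβ i, ← Finset.sum_neg_distrib]
      exact Finset.sum_congr rfl fun k _ => by rw [hβk]; ring
    have hw : w = fun j => c * ξ j := by
      rw [← sub_eq_zero]
      refine eq_zero_of_forall_sum_eq_zero hspan fun k => ?_
      simp only [Pi.sub_apply, sub_mul, Finset.sum_sub_distrib, hc, mul_assoc, ← Finset.mul_sum,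
        hξC]
      ring
    rw [Submodule.mem_span_singleton]
    refine ⟨c, Prod.ext (Subtype.ext (funext fun k => ?_)) ?_⟩
    · change c * -(b k) = β k
      rw [hβk, hc]; ring
    · rw [hw]; rfl
  have hdim : Fintype.card ι - 1 ≤ finrank ℂ (LinearMap.range D) := by
    have h1 := LinearMap.finrank_range_add_finrank_ker D
    have h2 := (Submodule.finrank_mono hker).trans (finrank_span_le_card _)
    rw [Set.toFinset_singleton, Finset.card_singleton] at h2
    have h3 : finrank ℂ L + (n + 1) = Fintype.card ι := finrank_complexRelations hspan
    rw [finrank_prod, finrank_fin_fun] at h1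
    omega
  -- a linear slice through `(b, 0)` on which `D` is injective
  obtain ⟨f, hf⟩ := exists_injective_of_le_finrank hdim
  obtain ⟨σ, hσ⟩ := D.rangeRestrict.exists_rightInverse_of_surjective D.range_rangeRestrict
  let J : (Fin (Fintype.card ι - 1) → ℂ) →ₗ[ℂ] ((ι → ℂ) × (Fin (n + 1) → ℂ)) := I ∘ₗ σ ∘ₗ f
  have hJ : ∀ u, (J u).1 ∈ L := fun u => (σ (f u)).1.2
  have hDJ : ∀ u, logDeriv A b (J u) = f u := fun u =>
    congrArg Subtype.val (LinearMap.congr_fun hσ (f u))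
  let Jc := LinearMap.toContinuousLinearMap J
  let φ : (Fin (Fintype.card ι - 1) → ℂ) → (ι → ℂ) := fun u => hornKapranov A ((b, 0) + Jc u)
  have hφ : ContDiff ℂ 1 φ := (contDiff_hornKapranov A).comp (by fun_prop)
  have hφ' : ∀ u, fderiv ℂ φ u = (fderiv ℂ (hornKapranov A) ((b, 0) + Jc u)).comp Jc := by
    intro u
    have h1 : HasFDerivAt (fun u => ((b, 0) : (ι → ℂ) × (Fin (n + 1) → ℂ)) + Jc u) Jc u :=
      Jc.hasFDerivAt.const_add _
    exact (((contDiff_hornKapranov A).differentiable one_ne_zero _).hasFDerivAt.comp u h1).fderiv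
  refine ⟨{u | (∀ k, ((b, 0) + Jc u).1 k ≠ 0) ∧ Function.Injective (fderiv ℂ φ u)}, φ,
    ?_, ⟨0, ?_, ?_⟩, (hφ.differentiable one_ne_zero).differentiableOn, fun u hu => hu.2,
    fun u hu => ?_⟩
  · refine IsOpen.inter ?_ ?_
    · change IsOpen {u | ∀ k, ((b, 0) + Jc u).1 k ≠ 0}
      simp only [Set.ofPred_forall]
      refine isOpen_iInter_of_finite fun k => isOpen_ne_fun ?_ continuous_const
      fun_prop
    · exact ContinuousLinearMap.isOpen_injective.preimage (hφ.continuous_fderiv one_ne_zero)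
  · intro k
    simpa using hb.ne_zero k
  · rw [hφ', injective_iff_map_eq_zero]
    intro u hu
    apply hf
    rw [map_zero]
    ext k
    have h1 := congrFun hu k
    rw [ContinuousLinearMap.comp_apply, fderiv_hornKapranov_apply] at h1
    rw [← hDJ]
    have h2 := (mul_eq_zero.1 h1).resolve_left (Complex.exp_ne_zero _)
    simpa [Jc] using h2
  · have h1 : (b, 0) + Jc u = (b + (J u).1, (J u).2) := by
      ext <;> simp [Jc]
    change hornKapranov A ((b, 0) + Jc u) ∈ _
    have h2 := hu.1
    rw [h1] at h2 ⊢
    exact hornKapranov_mem_dualVariety hξ (Submodule.add_mem _ hbmem (hJ u)) h2 _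

theorem finrank_inf_ker_add_one {𝕜 V : Type*} [Field 𝕜] [AddCommGroup V] [Module 𝕜 V]
    [FiniteDimensional 𝕜 V] {L : Submodule 𝕜 V} {f : V →ₗ[𝕜] 𝕜} {v : V} (hv : v ∈ L)
    (hf : f v ≠ 0) : finrank 𝕜 ↥(L ⊓ LinearMap.ker f) + 1 = finrank 𝕜 L := by
  have h := LinearMap.finrank_range_add_finrank_ker (f ∘ₗ L.subtype)
  have hr : LinearMap.range (f ∘ₗ L.subtype) = ⊤ := by
    rw [LinearMap.range_eq_top]
    intro z
    exact ⟨(z / f v) • ⟨v, hv⟩, by simp [hf]⟩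
  have hk : finrank 𝕜 (LinearMap.ker (f ∘ₗ L.subtype)) = finrank 𝕜 ↥(L ⊓ LinearMap.ker f) := by
    rw [LinearMap.ker_comp, ← Submodule.map_comap_subtype,
      LinearEquiv.finrank_eq (Submodule.equivMapOfInjective _ L.injective_subtype _)]
  rw [hr, finrank_top, finrank_self] at h
  omega

/-- If the dual variety contains a hypersurface, then the parametrization has maximal rank
somewhere: otherwise its composition with a projection to `ℂ^(N-1)` would have critical points
only, and by Sard's lemma its image would be a null set. -/
theorem exists_isNondegenerateComplex {A : ι → Fin (n + 1) → ℝ} (hA : IsSpectrum A) {d : ℕ}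
    (hd : Fintype.card ι ≤ d + 1) (hS : ContainsManifoldOfDim (dualVariety A) d) :
    ∃ b, IsNondegenerateComplex A b := by
  obtain ⟨⟨ξ, hξ⟩, hspan⟩ := hA
  have hξC : ∀ k, ∑ j, (ξ j : ℂ) * (A k j : ℂ) = 1 := fun k => by exact_mod_cast hξ k
  by_contra hcon
  obtain ⟨P, hP⟩ := hS.exists_projection (m := Fintype.card ι - 1) (by omega)
  obtain ⟨k₀⟩ : Nonempty ι := by
    by_contra hne
    rw [not_nonempty_iff] at hne
    rw [Set.range_eq_empty, Submodule.span_empty] at hspan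
    exact bot_ne_top hspan
  obtain ⟨c₀, hc₀⟩ : (dualVariety A).Nonempty :=
    Set.image_nonempty.1 (hP.mono interior_subset)
  obtain ⟨b₀, hb₀, -, hb₀1, -⟩ := exists_hornKapranov_eq hξ hc₀ k₀
  set L := complexRelations A with hL
  -- normalizing the coordinate `k₀` of the relation to `1` removes the redundant parameter, so that
  -- the parameter space has dimension `N - 1`
  let K : Submodule ℂ (ι → ℂ) := L ⊓ LinearMap.ker (LinearMap.proj k₀)
  have hdim : finrank ℂ (Fin (Fintype.card ι - 1) → ℂ) = finrank ℂ (K × (Fin (n + 1) → ℂ)) := by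
    have h1 : finrank ℂ K + 1 = finrank ℂ L := finrank_inf_ker_add_one hb₀ (by simp [hb₀1])
    have h2 : finrank ℂ L + (n + 1) = Fintype.card ι := finrank_complexRelations hspan
    rw [finrank_prod, finrank_fin_fun, finrank_fin_fun]
    omega
  let e := LinearEquiv.ofFinrankEq _ _ hdim
  let J : (Fin (Fintype.card ι - 1) → ℂ) →ₗ[ℂ] ((ι → ℂ) × (Fin (n + 1) → ℂ)) :=
    K.subtype.prodMap LinearMap.id ∘ₗ e.toLinearMap
  let Jc := LinearMap.toContinuousLinearMap J
  let Pc := LinearMap.toContinuousLinearMap P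
  let Ψ : (Fin (Fintype.card ι - 1) → ℂ) → (Fin (Fintype.card ι - 1) → ℂ) :=
    fun x => Pc (hornKapranov A ((b₀, 0) + Jc x))
  let s : Set (Fin (Fintype.card ι - 1) → ℂ) := {x | ∀ k, ((b₀, 0) + Jc x).1 k ≠ 0}
  let Ψ' : (Fin (Fintype.card ι - 1) → ℂ) → _ := fun x =>
    (Pc.comp ((fderiv ℂ (hornKapranov A) ((b₀, 0) + Jc x)).comp Jc)).restrictScalars ℝ
  have hΨ : ∀ x ∈ s, HasFDerivWithinAt Ψ (Ψ' x) s x := by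
    intro x _
    have h1 : HasFDerivAt (fun u => ((b₀, 0) : (ι → ℂ) × (Fin (n + 1) → ℂ)) + Jc u) Jc x :=
      Jc.hasFDerivAt.const_add _
    have h2 := ((contDiff_hornKapranov A).differentiable one_ne_zero _).hasFDerivAt.comp x h1
    exact ((Pc.hasFDerivAt.comp x h2).restrictScalars ℝ).hasFDerivWithinAt
  have hdet : ∀ x ∈ s, (Ψ' x).det = 0 := by
    intro x hx
    set b : ι → ℂ := ((b₀, 0) + Jc x).1 with hb
    have hbL : b ∈ L := Submodule.add_mem _ hb₀ (e x).1.2.1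
    -- a degenerate direction, normalized to preserve the coordinate `k₀`
    have hdeg : ¬ IsNondegenerateComplex A b := fun h => hcon ⟨b, h⟩
    obtain ⟨w, hw, hwc⟩ : ∃ w : Fin (n + 1) → ℂ,
        (∀ i, ∑ k, b k * (∑ j, w j * (A k j : ℂ)) * (A k i : ℂ) = 0) ∧
          ∀ c : ℂ, ∃ k, ∑ j, w j * (A k j : ℂ) ≠ c := by
      by_contra! hall
      exact hdeg ⟨hx, mem_complexRelations.1 hbL, hall⟩
    set t := ∑ j, w j * (A k₀ j : ℂ) with ht
    obtain ⟨k₁, hk₁⟩ := hwc t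
    set w' : Fin (n + 1) → ℂ := fun j => w j - t * ξ j with hw'
    have hw'k : ∀ k, ∑ j, w' j * (A k j : ℂ) = ∑ j, w j * (A k j : ℂ) - t := by
      intro k
      simp only [hw', sub_mul, Finset.sum_sub_distrib, mul_assoc, ← Finset.mul_sum, hξC, mul_one]
    let β : ι → ℂ := fun k => -(b k * ∑ j, w' j * (A k j : ℂ))
    have hβL : β ∈ L := by
      rw [hL, mem_complexRelations]
      intro i
      have h1 := mem_complexRelations.1 hbL i
      have h2 := hw i
      calc ∑ k, β k * (A k i : ℂ) = t * ∑ k, b k * (A k i : ℂ) -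
            ∑ k, b k * (∑ j, w j * (A k j : ℂ)) * (A k i : ℂ) := by
            rw [Finset.mul_sum, ← Finset.sum_sub_distrib]
            exact Finset.sum_congr rfl fun k _ => by simp only [β, hw'k]; ring
        _ = 0 := by rw [h1, h2, mul_zero, sub_zero]
    have hβK : β ∈ K := by
      refine ⟨hβL, ?_⟩
      change -(b k₀ * ∑ j, w' j * (A k₀ j : ℂ)) = 0
      rw [hw'k, ← ht, sub_self, mul_zero, neg_zero]
    set y := e.symm (⟨β, hβK⟩, w') with hy
    have hJy : Jc y = (β, w') := by
      change (K.subtype.prodMap LinearMap.id) (e y) = _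
      rw [hy, LinearEquiv.apply_symm_apply]
      rfl
    have hy0 : y ≠ 0 := by
      intro h0
      rw [h0, map_zero] at hJy
      have hw'0 : w' = 0 := (congrArg Prod.snd hJy).symm
      apply hk₁
      have := hw'k k₁
      rw [hw'0] at this
      exact sub_eq_zero.1 (by simpa using this.symm)
    have hΨy : Ψ' x y = 0 := by
      have h1 : fderiv ℂ (hornKapranov A) ((b₀, 0) + Jc x) (Jc y) = 0 := by
        ext k
        rw [fderiv_hornKapranov_apply, hJy]
        simp [logDeriv, β, ← hb]
      change Pc (fderiv ℂ (hornKapranov A) ((b₀, 0) + Jc x) (Jc y)) = 0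
      rw [h1, map_zero]
    by_contra hne
    apply hy0
    have hinj := (LinearMap.equivOfDetNeZero _ hne).injective
    apply hinj
    rw [map_zero]
    exact hΨy
  -- Sard's lemma for maps between spaces of the same dimension, regarded over `ℝ`
  have hnull := MeasureTheory.addHaar_image_eq_zero_of_det_fderivWithin_eq_zero
    MeasureTheory.volume hΨ hdet
  have hsub : P '' dualVariety A ⊆ Ψ '' s := by
    rintro _ ⟨c, hc, rfl⟩
    obtain ⟨b, hb, hb0, hb1, w, rfl⟩ := exists_hornKapranov_eq hξ hc k₀
    have hK : b - b₀ ∈ K := by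
      refine ⟨Submodule.sub_mem _ hb hb₀, ?_⟩
      change b k₀ - b₀ k₀ = 0
      rw [hb1, hb₀1, sub_self]
    have hJ : (b₀, 0) + Jc (e.symm (⟨_, hK⟩, w)) = (b, w) := by
      have : Jc (e.symm (⟨_, hK⟩, w)) = (b - b₀, w) := by
        change (K.subtype.prodMap LinearMap.id)
          (e (e.symm (⟨_, hK⟩, w))) = _
        rw [LinearEquiv.apply_symm_apply]
        rfl
      rw [this]
      ext <;> simp
    refine ⟨e.symm (⟨_, hK⟩, w), ?_, ?_⟩
    · have hmem : ∀ k, ((b₀, 0) + Jc (e.symm (⟨_, hK⟩, w))).1 k ≠ 0 := by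
        rw [hJ]
        exact hb0
      exact hmem
    · change Pc (hornKapranov A ((b₀, 0) + Jc _)) = _
      rw [hJ]
      rfl
  have hpos := isOpen_interior.measure_pos MeasureTheory.volume hP
  exact hpos.ne' (MeasureTheory.measure_mono_null (interior_subset.trans hsub) hnull)

theorem isDualDefective_iff {A : ι → Fin (n + 1) → ℝ} (hA : IsSpectrum A) :
    IsDualDefective A ↔ ¬ ∃ b, IsNondegenerateComplex A b := by
  constructor
  · rintro h ⟨b, hb⟩
    have := h _ (hb.containsManifoldOfDim hA)
    omega
  · intro h d hS
    by_contra hd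
    exact h (exists_isNondegenerateComplex hA (by omega) hS)

end Param

/-! ### Characterization of dual defective spectra -/

theorem IsSpectrum.exists_dual {ι : Type*} {n : ℕ} {A : ι → Fin (n + 1) → ℝ} (hA : IsSpectrum A) :
    ∃ ξ : Dual ℝ (Fin (n + 1) → ℝ), ∀ k, ξ (A k) = 1 := by
  obtain ⟨⟨ξ, hξ⟩, -⟩ := hA
  refine ⟨∑ j, ξ j • LinearMap.proj j, fun k => ?_⟩
  simpa [dotProduct] using hξ k

theorem IsSpectrum.nonempty {ι : Type*} {n : ℕ} {A : ι → Fin (n + 1) → ℝ} (hA : IsSpectrum A) :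
    Nonempty ι := by
  by_contra hne
  rw [not_nonempty_iff] at hne
  have hspan := hA.2
  rw [Set.range_eq_empty, Submodule.span_empty] at hspan
  exact bot_ne_top hspan

theorem IsChain.exists_ne_base {ι V : Type*} [AddCommGroup V] [Module ℝ V] [DecidableEq ι]
    {A : ι → V} {p : ι} {s : Finset ι} {r : ℕ} {lev : ι → ℕ} (h : IsChain A p s r lev)
    (hr : 0 < r) : ∃ k ∈ s, k ≠ p := by
  obtain ⟨l, -, hl, -⟩ := h.circuit 0 hr
  obtain ⟨k, hk, -⟩ := Finset.exists_ne_zero_of_sum_ne_zero hl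
  rw [Finset.mem_filter] at hk
  exact ⟨k, hk.1, hk.2.1⟩

theorem IsNondegenerate.containsIteratedCircuit {ι : Type*} [Fintype ι] {n : ℕ}
    {A : ι → Fin (n + 1) → ℝ} (hA : IsSpectrum A) {b : ι → ℝ}
    (hb : IsNondegenerate A Finset.univ b) : ContainsIteratedCircuit A := by
  classical
  obtain ⟨ξ, hξ⟩ := hA.exists_dual
  have := hA.nonempty
  obtain ⟨p, s, r, lev, -, hr, hch, hspan⟩ := hb.exists_chain hξ Finset.univ_nonempty
  rw [Finset.coe_univ, Set.image_univ, hA.2, top_le_iff] at hspan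
  exact ⟨s, hch.isIteratedCircuit hξ hr hspan⟩

/-- The relation of an iterated circuit, extended by zero, is a relation whose quadratic form has
the smallest possible radical, since a linear form is determined by its values on a spanning
subfamily. -/
theorem ContainsIteratedCircuit.exists_isNondegenerate {ι : Type*} [Fintype ι] {n : ℕ}
    {A : ι → Fin (n + 1) → ℝ} (hA : IsSpectrum A) (h : ContainsIteratedCircuit A) :
    ∃ b, IsNondegenerate A Finset.univ b := by
  classical
  obtain ⟨ξ, hξ⟩ := hA.exists_dual
  obtain ⟨s, F, hr, hF⟩ := h
  obtain ⟨p, lev, hch, hspan⟩ := F.exists_isChain hF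
  obtain ⟨k, -, hk⟩ := hch.exists_ne_base hr
  have : Nontrivial ι := ⟨⟨k, p, fun h => hk (Subtype.ext h)⟩⟩
  obtain ⟨b, hb, hrad⟩ := IsChain.exists_relation (A := fun k : s => A k) (ξ := ξ)
    (fun k => hξ k) hch
  have hext : ∀ k : s, Function.extend Subtype.val b 0 (k : ι) = b k :=
    Subtype.val_injective.extend_apply b 0
  have hext0 : ∀ k ∉ Set.range (Subtype.val : s → ι), Function.extend Subtype.val b 0 k = 0 :=
    fun k hk => Function.extend_apply' _ _ _ hk
  refine exists_isNondegenerate_univ hξ (b := Function.extend Subtype.val b 0)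
    ⟨fun k hk => absurd (Finset.mem_univ k) hk, ?_⟩ fun v hv => ?_
  · rw [← (mem_relations.1 hb).2]
    exact (Fintype.sum_of_injective _ Subtype.val_injective _ _
      (fun k hk => by rw [hext0 k hk, zero_smul]) fun k => by rw [hext]).symm
  · obtain ⟨c, hc⟩ := hrad v (by
      rw [← hv]
      exact Fintype.sum_of_injective _ Subtype.val_injective _ _
        (fun k hk => by rw [hext0 k hk, zero_mul, zero_smul]) fun k => by rw [hext])
    have hvc : v = c • ξ := LinearMap.ext_on_range hspan fun k => by
      simp [hc k (Finset.mem_univ k), hξ]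
    exact ⟨c, fun k => by simp [hvc, hξ]⟩

end ExpSum

end

theorem mainTheorem1 {ι : Type*} [Fintype ι] {n : ℕ} (A : ι → Fin (n + 1) → ℝ)
    (hA : ExpSum.IsSpectrum A) :
    ExpSum.IsDualDefective A ↔ ¬ ExpSum.ContainsIteratedCircuit A := by
  rw [ExpSum.isDualDefective_iff hA, not_iff_not]
  constructor
  · rintro ⟨b, hb⟩
    obtain ⟨b', hb'⟩ := hb.exists_real hA
    exact hb'.containsIteratedCircuit hA
  · intro h
    obtain ⟨b, hb⟩ := h.exists_isNondegenerate hA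
    exact ⟨_, hb.complex⟩
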